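/- Let $\mathbb{K}$ be a field of characteristic $0$, let $(R,\mathfrak{m})$ be a parameter $\mathbb{K}$-algebra (a complete noetherian local commutative $\mathbb{K}$-algebra with residue field $R/\mathfrak{m}=\mathbb{K}$), and let $C$ be a smooth integral commutative $\mathbb{K}$-algebra (smooth meaning in particular finitely presented; integral meaning an integral domain). For a $\mathbb{K}$-module $V$ let $R\,\widehat{\otimes}_{\mathbb{K}}V$ be the $\mathfrak{m}$-adic completion of $R\otimes_{\mathbb{K}}V$, and let $\mathfrak{m}\,\widehat{\otimes}_{\mathbb{K}}V$ be the kernel of the augmentation $R\,\widehat{\otimes}_{\mathbb{K}}V\to V$ induced by $R\to R/\mathfrak{m}=\mathbb{K}$. Let $A:=R\,\widehat{\otimes}_{\mathbb{K}}C$, an $R$-module with augmentation $A\to C$ and distinguished element $1_A:=1_R\otimes 1_C$; identify $c\in C$ with $1_R\otimes c\in A$. A star product on $A$ is an $R$-bilinear associative product $\star:A\times A\to A$ with unit $1_A$ such that $c_1\star c_2\equiv c_1c_2 \bmod \mathfrak{m}A$ for all $c_1,c_2\in C$. A gauge transformation of $A$ is an $R$-module automorphism of $A$ that commutes with the augmentation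 $A\to C$ and fixes $1_A$. Let $\mathcal{D}$ be the $\mathbb{K}$-module of normalized bidifferential operators on $C$, i.e. of $\mathbb{K}$-linear maps $\phi:C\otimes_{\mathbb{K}}C\to C$ with $\phi(1\otimes c)=\phi(c\otimes 1)=0$ for all $c\in C$ that are differential operators (in Grothendieck's sense, of some finite order) over the $\mathbb{K}$-algebra $C\otimes_{\mathbb{K}}C$, where $C$ is a $C\otimes_{\mathbb{K}}C$-module through multiplication. A star product $\star$ is differential if there is $\beta\in\mathfrak{m}\,\widehat{\otimes}_{\mathbb{K}}\mathcal{D}$ such that $c_1\star c_2=c_1c_2+\beta(c_1,c_2)$ for all $c_1,c_2\in C$, where $\beta(c_1,c_2)\in A$ is the image of $\beta$ under the map $R\,\widehat{\otimes}_{\mathbb{K}}\mathcal{D}\to R\,\widehat{\otimes}_{\mathbb{K}}C$ induced by evaluation $\phi\mapsto\phi(c_1\otimes c_2)$. Theorem. Every star product on $A$ is gauge equivalent to a differential star product: for every star product $\star$ on $A$ there exist a gauge transformation $g:A\to A$ and a differential star product $\star'$ on $A$ such that \[ g(a_1\star a_2)=g(a_1)\star' g(a_2)\qquad\text{for all } a_1,a_2\in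 A. \] -/

import Mathlib

open TensorProduct IsLocalRing

namespace StarProduct

/-- A local `K`-algebra `R` is a parameter algebra if it is noetherian, complete (and separated)
for its maximal ideal, and its residue field is `K` (via the structure map). -/
class IsParameterAlgebra (K R : Type*) [Field K] [CommRing R] [Algebra K R] [IsLocalRing R] :
    Prop where
  isNoetherianRing : IsNoetherianRing R
  isAdicComplete : IsAdicComplete (maximalIdeal R) R
  bijective_residue : Function.Bijective (algebraMap K (ResidueField R))

section Completion

variable (K R : Type*) [Field K] [CommRing R] [Algebra K R] [IsLocalRing R]

/-- The augmentation `R → K` of a parameter algebra. -/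
noncomputable def augmentation [IsParameterAlgebra K R] : R →+* K :=
  ((RingEquiv.ofBijective (algebraMap K (ResidueField R))
    (IsParameterAlgebra.bijective_residue (K := K) (R := R))).symm :
      ResidueField R →+* K).comp (residue R)

theorem augmentation_algebraMap [IsParameterAlgebra K R] (k : K) :
    augmentation K R (algebraMap K R k) = k := by
  have h : residue R (algebraMap K R k) = algebraMap K (ResidueField R) k :=
    (IsScalarTower.algebraMap_apply K R (ResidueField R) k).symm
  simp only [augmentation, RingHom.comp_apply, h]
  exact (RingEquiv.ofBijective (algebraMap K (ResidueField R))
    (IsParameterAlgebra.bijective_residue (K := K) (R := R))).symm_apply_apply k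

theorem augmentation_eq_zero [IsParameterAlgebra K R] {r : R} (hr : r ∈ maximalIdeal R) :
    augmentation K R r = 0 := by
  have h : residue R r = 0 := Ideal.Quotient.eq_zero_iff_mem.mpr hr
  simp [augmentation, h]

variable (V : Type*) [AddCommGroup V] [Module K V]

/-- The completed tensor product of `R` and a `K`-module `V`: the adic completion of `R ⊗ V`
for the maximal ideal of `R`. -/
abbrev CompletedTensor : Type _ := AdicCompletion (maximalIdeal R) (R ⊗[K] V)

variable {V} in
/-- The element `1 ⊗ v` of the completed tensor product. -/
noncomputable def incl (v : V) : CompletedTensor K R V :=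
  AdicCompletion.of (maximalIdeal R) (R ⊗[K] V) (1 ⊗ₜ[K] v)

/-- The map `R ⊗ V → V`, `r ⊗ v ↦ ε(r) v`, semilinear over the augmentation `ε : R → K`. -/
noncomputable def augTensor [IsParameterAlgebra K R] : R ⊗[K] V →ₛₗ[augmentation K R] V where
  toFun := TensorProduct.lift (LinearMap.mk₂ K (fun (r : R) (v : V) => augmentation K R r • v)
    (fun r s v => by rw [map_add, add_smul])
    (fun k r v => by
      rw [Algebra.smul_def, map_mul, augmentation_algebraMap, mul_smul])
    (fun r v w => by rw [smul_add])
    (fun k r v => by rw [smul_comm]))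
  map_add' := map_add _
  map_smul' r x := by
    induction x with
    | zero => simp
    | tmul s v => simp [TensorProduct.smul_tmul', mul_smul]
    | add x y hx hy => rw [smul_add, map_add, map_add, hx, hy, smul_add]

theorem augTensor_ker [IsParameterAlgebra K R] :
    (maximalIdeal R ^ 1 • ⊤ : Submodule R (R ⊗[K] V)) ≤ LinearMap.ker (augTensor K R V) := by
  rw [pow_one, Submodule.smul_le]
  intro r hr x _
  rw [LinearMap.mem_ker, LinearMap.map_smulₛₗ, augmentation_eq_zero K R hr, zero_smul]

/-- The augmentation of the completed tensor product, with values in `V`. Its kernel is the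
completed tensor product of `V` with the maximal ideal of `R`. -/
noncomputable def aug [IsParameterAlgebra K R] : CompletedTensor K R V →ₛₗ[augmentation K R] V :=
  ((maximalIdeal R ^ 1 • ⊤ : Submodule R (R ⊗[K] V)).liftQ (augTensor K R V)
    (augTensor_ker K R V)).comp (AdicCompletion.eval (maximalIdeal R) (R ⊗[K] V) 1)

variable {V} in
/-- The `R`-linear extension of a `K`-linear map to completed tensor products. -/
noncomputable def completedMap {W : Type*} [AddCommGroup W] [Module K W] (f : V →ₗ[K] W) :
    CompletedTensor K R V → CompletedTensor K R W :=
  AdicCompletion.map (maximalIdeal R) (f.baseChange R)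

end Completion

section DiffOp

variable {K B C : Type*} [Field K] [CommRing B] [Algebra K B] [CommRing C] [Algebra K C]

/-- Given `f : B → C` (by which `C` is a `B`-module), the commutator `[b, φ]` of `b ∈ B` with a
`K`-linear map `φ : B → C`, i.e. `x ↦ b • φ x - φ (b x)`. -/
def diffCommutator (f : B →ₐ[K] C) (b : B) (φ : B →ₗ[K] C) : B →ₗ[K] C :=
  LinearMap.mulLeft K (f b) ∘ₗ φ - φ ∘ₗ LinearMap.mulLeft K b

/-- Grothendieck's definition of a differential operator (relative to `K`) of order at most `n`
from `B` to the `B`-module `C`. -/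
def IsDiffOpOfOrder (f : B →ₐ[K] C) : ℕ → (B →ₗ[K] C) → Prop
  | 0, φ => ∀ b, diffCommutator f b φ = 0
  | n + 1, φ => ∀ b, IsDiffOpOfOrder f n (diffCommutator f b φ)

/-- A differential operator of some finite order. -/
def IsDiffOp (f : B →ₐ[K] C) (φ : B →ₗ[K] C) : Prop := ∃ n, IsDiffOpOfOrder f n φ

theorem diffCommutator_zero (f : B →ₐ[K] C) (b : B) : diffCommutator f b 0 = 0 := by
  ext x; simp [diffCommutator]

theorem diffCommutator_add (f : B →ₐ[K] C) (b : B) (φ ψ : B →ₗ[K] C) :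
    diffCommutator f b (φ + ψ) = diffCommutator f b φ + diffCommutator f b ψ := by
  ext x; simp [diffCommutator, mul_add]; ring

theorem diffCommutator_smul (f : B →ₐ[K] C) (b : B) (k : K) (φ : B →ₗ[K] C) :
    diffCommutator f b (k • φ) = k • diffCommutator f b φ := by
  ext x; simp [diffCommutator, smul_sub]

theorem IsDiffOpOfOrder.zero (f : B →ₐ[K] C) (n : ℕ) : IsDiffOpOfOrder f n 0 := by
  induction n with
  | zero => exact fun b => diffCommutator_zero f b
  | succ n ih => intro b; rw [diffCommutator_zero]; exact ih

theorem IsDiffOpOfOrder.succ {f : B →ₐ[K] C} {n : ℕ} {φ : B →ₗ[K] C}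
    (h : IsDiffOpOfOrder f n φ) : IsDiffOpOfOrder f (n + 1) φ := by
  induction n generalizing φ with
  | zero => intro b; rw [h b]; exact IsDiffOpOfOrder.zero f 0
  | succ n ih => exact fun b => ih (h b)

theorem IsDiffOpOfOrder.mono {f : B →ₐ[K] C} {m n : ℕ} (hmn : m ≤ n) {φ : B →ₗ[K] C}
    (h : IsDiffOpOfOrder f m φ) : IsDiffOpOfOrder f n φ := by
  induction hmn with
  | refl => exact h
  | step _ ih => exact ih.succ

theorem IsDiffOpOfOrder.add {f : B →ₐ[K] C} {n : ℕ} {φ ψ : B →ₗ[K] C}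
    (h : IsDiffOpOfOrder f n φ) (h' : IsDiffOpOfOrder f n ψ) :
    IsDiffOpOfOrder f n (φ + ψ) := by
  induction n generalizing φ ψ with
  | zero => intro b; rw [diffCommutator_add, h b, h' b, add_zero]
  | succ n ih => intro b; rw [diffCommutator_add]; exact ih (h b) (h' b)

theorem IsDiffOpOfOrder.smul {f : B →ₐ[K] C} {n : ℕ} {φ : B →ₗ[K] C} (k : K)
    (h : IsDiffOpOfOrder f n φ) : IsDiffOpOfOrder f n (k • φ) := by
  induction n generalizing φ with
  | zero => intro b; rw [diffCommutator_smul, h b, smul_zero]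
  | succ n ih => intro b; rw [diffCommutator_smul]; exact ih (h b)

end DiffOp

section BiDiff

variable (K C : Type*) [Field K] [CommRing C] [Algebra K C]

/-- The `K`-module of normalized bidifferential operators on `C`: the Hochschild cochains
`φ : C ⊗ C → C` that vanish on `1 ⊗ c` and `c ⊗ 1` and that are differential operators over the
algebra `C ⊗ C`, which acts on `C` through the multiplication map `C ⊗ C → C`. -/
def NormalizedBiDiffOp : Submodule K (C ⊗[K] C →ₗ[K] C) where
  carrier := {φ | (∀ c : C, φ (1 ⊗ₜ c) = 0 ∧ φ (c ⊗ₜ 1) = 0) ∧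
    IsDiffOp (Algebra.TensorProduct.lmul' K (S := C)) φ}
  zero_mem' := ⟨fun _ => ⟨rfl, rfl⟩, 0, IsDiffOpOfOrder.zero _ 0⟩
  add_mem' := by
    rintro φ ψ ⟨h, m, hm⟩ ⟨h', n, hn⟩
    refine ⟨fun c => ?_, max m n, (hm.mono (le_max_left m n)).add (hn.mono (le_max_right m n))⟩
    simp [h c, h' c]
  smul_mem' := by
    rintro k φ ⟨h, m, hm⟩
    exact ⟨fun c => by simp [h c], m, hm.smul k⟩

variable {C} in
/-- Evaluation of normalized bidifferential operators at a pair of elements of `C`. -/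
def evalBiDiff (c₁ c₂ : C) : NormalizedBiDiffOp K C →ₗ[K] C :=
  (LinearMap.applyₗ (c₁ ⊗ₜ[K] c₂)) ∘ₗ (NormalizedBiDiffOp K C).subtype

end BiDiff

section Star

variable (K R C : Type*) [Field K] [CommRing R] [Algebra K R] [IsLocalRing R]
  [CommRing C] [Algebra K C]

/-- Star products on the `R`-module `A`, the completed tensor product of `R` and `C`:
`R`-bilinear associative products on `A` with unit `1 ⊗ 1` that agree with the product
of `C` modulo the maximal ideal of `R`. -/
structure IsStarProduct
    (μ : CompletedTensor K R C →ₗ[R] CompletedTensor K R C →ₗ[R] CompletedTensor K R C) :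
    Prop where
  assoc : ∀ a b c, μ (μ a b) c = μ a (μ b c)
  one_left : ∀ a, μ (incl K R (1 : C)) a = a
  one_right : ∀ a, μ a (incl K R (1 : C)) = a
  mod_max : ∀ c₁ c₂ : C, μ (incl K R c₁) (incl K R c₂) - incl K R (c₁ * c₂) ∈
    (maximalIdeal R • ⊤ : Submodule R (CompletedTensor K R C))

/-- A star product `⋆` is differential if `c₁ ⋆ c₂ = c₁ c₂ + β(c₁, c₂)` on `C` for an element `β`
of the completed tensor product of the maximal ideal of `R` with the module of normalized
bidifferential operators, i.e. of the kernel of the augmentation of `CompletedTensor K R` of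
that module. -/
structure IsDifferentialStarProduct [IsParameterAlgebra K R]
    (μ : CompletedTensor K R C →ₗ[R] CompletedTensor K R C →ₗ[R] CompletedTensor K R C) :
    Prop extends IsStarProduct K R C μ where
  differential : ∃ β : CompletedTensor K R (NormalizedBiDiffOp K C),
    aug K R (NormalizedBiDiffOp K C) β = 0 ∧
    ∀ c₁ c₂ : C, μ (incl K R c₁) (incl K R c₂) =
      incl K R (c₁ * c₂) + completedMap K R (evalBiDiff K c₁ c₂) β

/-- Gauge transformations of the augmented `R`-module `A` with distinguished element `1 ⊗ 1`. -/
structure IsGaugeTransformation [IsParameterAlgebra K R]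
    (g : CompletedTensor K R C ≃ₗ[R] CompletedTensor K R C) : Prop where
  aug_comp : ∀ a, aug K R C (g a) = aug K R C a
  map_one : g (incl K R (1 : C)) = incl K R (1 : C)

end Star

end StarProduct

/-! The star product is made differential one power of `𝔪` at a time. If it is differential modulo
`𝔪 ^ n`, its remainder modulo `𝔪 ^ (n + 1)` is `∑ tᵢ γᵢ`, where the `tᵢ` represent a basis of `𝔪 ^ n
/ 𝔪 ^ (n + 1)` and the `γᵢ` are normalized Hochschild 2-cochains of `C`. Associativity expresses the
coboundary of each `γᵢ` through operators already known to be differential. If `γᵢ - dηᵢ` is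
bidifferential, the gauge transformation `1 + ∑ tᵢ ηᵢ` gains one power of `𝔪` (`exists_gauge_step`).
The composites of these transformations converge because `A` is complete, and the approximations of
the limit product glue to a single `β` (`exists_completedMap_eq`).

The core is `exists_sub_coboundaryOne_mem`, which produces `ηᵢ`. Put `S = C ⊗ C` with diagonal ideal
`I`. Then `End_K C` is `Hom_C(S, C)`, and operators of order at most `n` are the functionals that
kill `I ^ (n + 1)`. A cochain with differential coboundary is a map `C → End_K C` that is a
derivation modulo operators of bounded order. Extended `C`-linearly, it gives a pairing of `I` with
`I ^ N` that is balanced over `S`. By Artin-Rees this pairing, restricted to a smaller power `I ^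
M`, factors through a functional on `I ^ (M + 1)`. By smoothness `S ⧸ I ^ (M + 1)` is projective
over `C`, so the functional extends to `S`; up to sign and normalization it is `η`. Then `γ - dη` is
differential in its second argument, and the coboundary formula carries this over to the first. -/

namespace StarProduct

/-! ### Projectivity of the algebras of principal parts -/

section Projective

/-- Truncation below total degree `n` is linear and kills the `n`-th power of the ideal of
variables, so it descends to a section of the quotient map from a free module. -/
theorem projective_mvPolynomial_quotient_pow {σ A : Type*} [Finite σ] [CommRing A] (n : ℕ) :
    Module.Projective A (MvPolynomial σ A ⧸ MvPolynomial.idealOfVars σ A ^ n) := by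
  let I := (MvPolynomial.idealOfVars σ A ^ n)
  let tr : MvPolynomial σ A →ₗ[A] MvPolynomial σ A :=
    (MvPowerSeries.truncTotal n) ∘ₗ
      (MvPolynomial.coeToMvPowerSeries.algHom (R := A) (σ := σ) A).toLinearMap
  have coeff_tr (p : MvPolynomial σ A) (x : σ →₀ ℕ) :
      (tr p).coeff x = if x.degree < n then p.coeff x else 0 := by
    simp [tr, MvPowerSeries.coeff_truncTotal_eq_ite]
  let N : Submodule A (MvPolynomial σ A) := I.restrictScalars A
  let i : (MvPolynomial σ A ⧸ N) →ₗ[A] MvPolynomial σ A :=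
    N.liftQ tr (fun p hp => by
      ext x
      rw [coeff_tr]
      split_ifs with h
      · simpa using (MvPolynomial.mem_pow_idealOfVars_iff' n p).1 hp x h
      · simp)
  have : Module.Projective A (MvPolynomial σ A ⧸ N) := by
    refine Module.Projective.of_split i N.mkQ (LinearMap.ext fun x => ?_)
    obtain ⟨p, rfl⟩ := N.mkQ_surjective x
    change N.mkQ (tr p) = N.mkQ p
    rw [← sub_eq_zero, ← map_sub, ← LinearMap.mem_ker, Submodule.ker_mkQ]
    refine (MvPolynomial.mem_pow_idealOfVars_iff' n _).2 fun x hx => ?_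
    rw [MvPolynomial.coeff_sub, coeff_tr, if_pos hx, sub_self]
  exact this

/-- A derivation into a nilpotent ideal is integrated to an algebra homomorphism. -/
theorem exists_algHom_sub_derivation_mem {K A T : Type*} [CommRing K] [CommRing A] [Algebra K A]
    [Algebra.FormallySmooth K A] [CommRing T] [Algebra K T] [Algebra A T] [IsScalarTower K A T]
    (J : Ideal T) (hJ : IsNilpotent J) (D : Derivation K A T) (hD : ∀ a, D a ∈ J) :
    ∃ σ : A →ₐ[K] T, ∀ a, σ a - algebraMap A T a - D a ∈ J ^ 2 := by
  -- `a ↦ a + D a` fails to be multiplicative only by `D x * D y`, which lies in `J ^ 2`.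
  let g : A →ₐ[K] T ⧸ J ^ 2 := AlgHom.ofLinearMap
    ((Ideal.Quotient.mkₐ K (J ^ 2)).toLinearMap ∘ₗ
      ((IsScalarTower.toAlgHom K A T).toLinearMap + D.toLinearMap)) (by simp) (by
    intro x y
    simp only [LinearMap.comp_apply, LinearMap.add_apply, AlgHom.toLinearMap_apply,
      IsScalarTower.coe_toAlgHom', Derivation.coeFn_coe, Ideal.Quotient.mkₐ_eq_mk, ← map_mul]
    rw [Ideal.Quotient.mk_eq_mk_iff_sub_mem]
    have : D x * D y ∈ J ^ 2 := by rw [pow_two]; exact Ideal.mul_mem_mul (hD x) (hD y)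
    rw [← neg_mem_iff]
    convert this using 1
    simp only [Derivation.leibniz, map_mul, Algebra.smul_def]
    ring)
  have hJ2 : IsNilpotent (J ^ 2) := hJ.pow_of_pos (by norm_num)
  obtain ⟨σ, hσ⟩ := Algebra.FormallySmooth.exists_lift (J ^ 2) hJ2 g
  refine ⟨σ, fun a => ?_⟩
  have := AlgHom.congr_fun hσ a
  rw [sub_sub, ← Ideal.Quotient.mk_eq_mk_iff_sub_mem]
  exact this

/-- A ring homomorphism that agrees to first order with the projection from `S` to `S ⧸ I ^ n`
is surjective with kernel `I ^ n`. -/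
theorem surjective_and_ker_eq_of_sub_mem {S : Type*} [CommRing S] (I : Ideal S) (n : ℕ)
    (θ : S →+* S ⧸ I ^ n)
    (h0 : ∀ s, θ s - Ideal.Quotient.mk (I ^ n) s ∈ I.map (Ideal.Quotient.mk (I ^ n)))
    (h1 : ∀ s ∈ I, θ s - Ideal.Quotient.mk (I ^ n) s ∈ I.map (Ideal.Quotient.mk (I ^ n)) ^ 2) :
    Function.Surjective θ ∧ RingHom.ker θ = I ^ n := by
  set m := Ideal.Quotient.mk (I ^ n)
  set J := I.map m
  have hJ : J ^ n = ⊥ := by rw [← Ideal.map_pow, Ideal.map_quotient_self]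
  have hmem {k : ℕ} {x : S} (hx : x ∈ I ^ k) : m x ∈ J ^ k := by
    rw [← Ideal.map_pow]; exact Ideal.mem_map_of_mem m hx
  have key (k : ℕ) : ∀ x ∈ I ^ k, θ x - m x ∈ J ^ (k + 1) := by
    induction k with
    | zero => intro x _; simpa using h0 x
    | succ k ih =>
      intro x hx
      rw [pow_succ] at hx
      refine Submodule.mul_induction_on hx (fun a ha b hb => ?_) (fun a b ha hb => ?_)
      · have e : θ (a * b) - m (a * b) = (θ a - m a) * θ b + m a * (θ b - m b) := by
          rw [map_mul, map_mul]; ring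
        have hb' : θ b ∈ J := by
          have := Ideal.pow_le_self (two_ne_zero) (h1 b hb)
          rw [← sub_add_cancel (θ b) (m b)]
          exact J.add_mem this (Ideal.mem_map_of_mem m hb)
        rw [e]
        refine Ideal.add_mem _ ?_ ?_
        · rw [pow_succ]; exact Ideal.mul_mem_mul (ih a ha) hb'
        · rw [add_assoc, pow_add]; exact Ideal.mul_mem_mul (hmem ha) (h1 b hb)
      · have e : θ (a + b) - m (a + b) = (θ a - m a) + (θ b - m b) := by
          rw [map_add, map_add]; ring
        rw [e]; exact Ideal.add_mem _ ha hb
  constructor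
  · have (k : ℕ) : ∀ q : S ⧸ I ^ n, ∃ x, q - θ x ∈ J ^ k := by
      induction k with
      | zero => intro q; exact ⟨0, by simp⟩
      | succ k ih =>
        intro q
        obtain ⟨x, hx⟩ := ih q
        rw [← Ideal.map_pow] at hx
        obtain ⟨y, hy, hyx⟩ := (Ideal.mem_map_iff_of_surjective m
          Ideal.Quotient.mk_surjective).1 hx
        refine ⟨x + y, ?_⟩
        have := key k y hy
        rw [hyx] at this
        rw [← neg_mem_iff, map_add]
        convert this using 1
        ring
    intro q
    obtain ⟨x, hx⟩ := this n q
    rw [hJ, Ideal.mem_bot, sub_eq_zero] at hx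
    exact ⟨x, hx.symm⟩
  · ext x
    rw [RingHom.mem_ker]
    constructor
    · intro hx
      have (k : ℕ) (hk : k ≤ n) : x ∈ I ^ k := by
        induction k with
        | zero => simp
        | succ k ih =>
          have h2 := key k x (ih (by lia))
          rw [hx, zero_sub, neg_mem_iff, ← Ideal.map_pow] at h2
          obtain ⟨y, hy, hyx⟩ := (Ideal.mem_map_iff_of_surjective m
            Ideal.Quotient.mk_surjective).1 h2
          rw [Ideal.Quotient.mk_eq_mk_iff_sub_mem] at hyx
          rw [← sub_sub_cancel y x]
          exact Ideal.sub_mem _ hy (Ideal.pow_le_pow_right hk hyx)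
      exact this n le_rfl
    · intro hx
      have h2 := key n x hx
      rw [Ideal.Quotient.eq_zero_iff_mem.2 hx, pow_succ, hJ] at h2
      simpa using h2

/-- A quotient module is projective if an automorphism of it factors through a projective module. -/
theorem projective_quotient_of_factor {A M T : Type*} [CommRing A] [AddCommGroup M] [Module A M]
    [AddCommGroup T] [Module A T] [Module.Projective A T] (N : Submodule A M)
    (Φ : M →ₗ[A] T) (Ψ : T →ₗ[A] M ⧸ N) (hΦ : ∀ x ∈ N, Φ x = 0)
    (hsurj : ∀ y, ∃ x, Ψ (Φ x) = y) (hinj : ∀ x, Ψ (Φ x) = 0 → x ∈ N) :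
    Module.Projective A (M ⧸ N) := by
  let Φ' : M ⧸ N →ₗ[A] T := N.liftQ Φ hΦ
  have hbij : Function.Bijective (Ψ ∘ₗ Φ') := by
    constructor
    · rw [← LinearMap.ker_eq_bot, LinearMap.ker_eq_bot']
      intro x hx
      obtain ⟨s, rfl⟩ := N.mkQ_surjective x
      exact (Submodule.Quotient.mk_eq_zero N).2 (hinj s hx)
    · intro q
      obtain ⟨s, rfl⟩ := hsurj q
      exact ⟨N.mkQ s, rfl⟩
  let e := LinearEquiv.ofBijective _ hbij
  refine Module.Projective.of_split Φ' (e.symm.toLinearMap ∘ₗ Ψ) (LinearMap.ext fun x => ?_)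
  exact e.symm_apply_apply x

/-- The algebras of principal parts of a smooth algebra are projective modules. -/
theorem projective_principalParts (K C : Type*) [CommRing K] [CommRing C] [Algebra K C]
    [Algebra.FormallySmooth K C] [Algebra.FiniteType K C] (n : ℕ) :
    Module.Projective C (C ⊗[K] C ⧸ KaehlerDifferential.ideal K C ^ n) := by
  set I := KaehlerDifferential.ideal K C
  set m := Ideal.Quotient.mk (I ^ n)
  set J := I.map m
  have hJ : J ^ n = ⊥ := by rw [← Ideal.map_pow, Ideal.map_quotient_self]
  obtain ⟨r, f, hf⟩ := Module.Finite.exists_fin' C Ω[C⁄K]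
  obtain ⟨i, hi⟩ := Module.projective_lifting_property f LinearMap.id hf
  -- The section `i` makes the Kähler differentials a summand of `C ^ r`; the `t j` lift to `I` the
  -- images of the standard basis vectors.
  have (j : Fin r) : ∃ t : I, KaehlerDifferential.fromIdeal K C t = f (Pi.single j 1) :=
    KaehlerDifferential.fromIdeal_surjective K C _
  choose t ht using this
  let X := MvPolynomial.idealOfVars (Fin r) C
  let T := MvPolynomial (Fin r) C ⧸ X ^ n
  let mT := Ideal.Quotient.mk (X ^ n)
  let JT : Ideal T := X.map mT
  have hJT : IsNilpotent JT := ⟨n, by rw [← Ideal.map_pow, Ideal.map_quotient_self]; rfl⟩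
  let ι : (Fin r → C) →ₗ[C] T :=
    Fintype.linearCombination C (fun j => mT (MvPolynomial.X j))
  have hX (j : Fin r) : mT (MvPolynomial.X j) ∈ JT :=
    Ideal.mem_map_of_mem _ (Ideal.subset_span ⟨j, rfl⟩)
  have hι (v : Fin r → C) : ι v ∈ JT := by
    simp only [ι, Fintype.linearCombination_apply]
    refine Ideal.sum_mem _ fun j _ => ?_
    exact (JT.restrictScalars C).smul_mem _ (hX j)
  -- `σ` plays the role of a Taylor expansion, with first-order part `a ↦ a + ι (i (D a))`.
  obtain ⟨σ, hσ⟩ := exists_algHom_sub_derivation_mem JT hJT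
    ((ι ∘ₗ i).compDer (KaehlerDifferential.D K C)) (fun a => hι _)
  let Φ : C ⊗[K] C →ₐ[C] T :=
    Algebra.TensorProduct.lift (Algebra.ofId C T) σ (fun _ _ => Commute.all _ _)
  let ψ : MvPolynomial (Fin r) C →ₐ[C] C ⊗[K] C ⧸ I ^ n :=
    MvPolynomial.aeval (fun j => m (t j : C ⊗[K] C))
  have hψX : X.map ψ ≤ J := by
    rw [Ideal.map_le_iff_le_comap, show X = Ideal.span _ from rfl, Ideal.span_le]
    rintro _ ⟨j, rfl⟩
    simpa [ψ] using Ideal.mem_map_of_mem m (t j).2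
  let Ψ : T →ₐ[C] C ⊗[K] C ⧸ I ^ n := Ideal.Quotient.liftₐ (X ^ n) ψ (fun a ha => by
    have h2 : ψ a ∈ (X ^ n).map ψ := Ideal.mem_map_of_mem _ ha
    rw [Ideal.map_pow] at h2
    simpa [hJ] using Ideal.pow_right_mono hψX n h2)
  have hΨ (p : MvPolynomial (Fin r) C) : Ψ (mT p) = ψ p := rfl
  have hΨJ : JT.map Ψ ≤ J := by
    rw [Ideal.map_le_iff_le_comap, show JT = X.map mT from rfl, Ideal.map_le_iff_le_comap]
    intro x hx
    exact hψX (Ideal.mem_map_of_mem _ hx)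
  let θ := Ψ.comp Φ
  -- It suffices to treat the generators `1 ⊗ a - a ⊗ 1`. Up to second order `Φ` sends such an
  -- element to `ι w`, and `Ψ` sends this to `∑ w j • t j`, which has the same class in `I / I ^ 2`
  -- because `f ∘ i = id`.
  have h1 : ∀ s ∈ I, θ s - m s ∈ J ^ 2 := by
    intro s hs
    have hs' : s ∈ I.restrictScalars C := hs
    rw [← KaehlerDifferential.submodule_span_range_eq_ideal] at hs'
    induction hs' using Submodule.span_induction with
    | mem x hx =>
      obtain ⟨a, rfl⟩ := hx
      set da : C ⊗[K] C := 1 ⊗ₜ[K] a - a ⊗ₜ[K] 1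
      have hda : da ∈ I := KaehlerDifferential.one_smul_sub_smul_one_mem_ideal K a
      have e1 : Φ da = σ a - algebraMap C T a := by
        simp [Φ, da, Algebra.ofId_apply]
      set w := i (KaehlerDifferential.D K C a)
      have e2 : Ψ (ι w) = m (∑ j, w j • (t j : C ⊗[K] C)) := by
        simp only [ι, Fintype.linearCombination_apply, map_sum, map_smul, hΨ]
        simp only [ψ, MvPolynomial.aeval_X]
        rfl
      have e3 : (∑ j, w j • (t j : C ⊗[K] C)) - da ∈ I ^ 2 := by
        have e4 : KaehlerDifferential.fromIdeal K C ⟨da, hda⟩ = f w :=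
          (LinearMap.congr_fun hi (KaehlerDifferential.D K C a)).symm
        have e6 : KaehlerDifferential.fromIdeal K C ((∑ j, w j • t j) - ⟨da, hda⟩) = 0 := by
          rw [map_sub, e4, map_sum, sub_eq_zero, LinearMap.pi_apply_eq_sum_univ f w]
          refine Finset.sum_congr rfl fun j _ => ?_
          have e7 : (fun k => if j = k then 1 else 0) = (Pi.single j 1 : Fin r → C) := by
            ext k; simp [Pi.single_apply, eq_comm]
          rw [e7, ← ht, ← algebraMap_smul (C ⊗[K] C) (w j) (t j), map_smul, algebraMap_smul]
        have := (Ideal.toCotangent_eq_zero I _).1 e6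
        simpa using this
      have e5 : θ da - m da = Ψ (σ a - algebraMap C T a - ι w) +
          m ((∑ j, w j • (t j : C ⊗[K] C)) - da) := by
        rw [RingHom.map_sub m _ da, ← e2, map_sub Ψ _ (ι w), ← e1]
        change Ψ (Φ da) - m da = _
        ring
      rw [e5]
      refine Ideal.add_mem _ ?_ ?_
      · refine Ideal.pow_right_mono hΨJ 2 ?_
        rw [← Ideal.map_pow]
        exact Ideal.mem_map_of_mem _ (hσ a)
      · rw [← Ideal.map_pow]
        exact Ideal.mem_map_of_mem _ e3
    | zero => simp
    | add x y hx hy h h' =>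
      have := Ideal.add_mem _ (h (KaehlerDifferential.submodule_span_range_eq_ideal K C ▸ hx :))
        (h' (KaehlerDifferential.submodule_span_range_eq_ideal K C ▸ hy :))
      rw [map_add, map_add]
      convert this using 1
      ring
    | smul c x hx h =>
      have := h (KaehlerDifferential.submodule_span_range_eq_ideal K C ▸ hx :)
      have e : θ (c • x) - m (c • x) = algebraMap C _ c * (θ x - m x) := by
        rw [map_smul, mul_sub, ← Algebra.smul_def, ← Algebra.smul_def]
        rfl
      rw [e]
      exact Ideal.mul_mem_left _ _ this
  -- Every `s` is an element of `I` plus a scalar from `C`, and both maps are `C`-linear.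
  have h0 : ∀ s, θ s - m s ∈ J := by
    intro s
    set c : C := Algebra.TensorProduct.lmul' K s
    have hs : s - algebraMap C _ c ∈ I := by
      simp [I, RingHom.mem_ker, c]
    have := Ideal.pow_le_self two_ne_zero (h1 _ hs)
    have e : θ s - m s = θ (s - algebraMap C _ c) - m (s - algebraMap C _ c) := by
      rw [map_sub, map_sub, AlgHom.commutes]
      have : m (algebraMap C _ c) = algebraMap C _ c := rfl
      rw [this]; ring
    rw [e]; exact this
  obtain ⟨hsurj, hker⟩ := surjective_and_ker_eq_of_sub_mem I n θ.toRingHom h0 h1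
  have hker' (s : C ⊗[K] C) : θ s = 0 ↔ s ∈ I ^ n := by
    have := SetLike.ext_iff.1 hker s
    exact this
  have hΦ : ∀ s ∈ I ^ n, Φ s = 0 := by
    have hΦI : I.map Φ ≤ JT := by
      have : I = Ideal.span _ := (KaehlerDifferential.span_range_eq_ideal K C).symm
      rw [this, Ideal.map_le_iff_le_comap, Ideal.span_le]
      rintro _ ⟨a, rfl⟩
      have e1 : Φ (1 ⊗ₜ[K] a - a ⊗ₜ[K] 1) = (σ a - algebraMap C T a -
          ι (i (KaehlerDifferential.D K C a))) + ι (i (KaehlerDifferential.D K C a)) := by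
        simp [Φ, Algebra.ofId_apply]
      simp only [SetLike.mem_coe, Ideal.mem_comap]
      rw [e1]
      exact Ideal.add_mem _ (Ideal.pow_le_self two_ne_zero (hσ a)) (hι _)
    intro s hs
    have h2 : Φ s ∈ (I ^ n).map Φ := Ideal.mem_map_of_mem _ hs
    rw [Ideal.map_pow] at h2
    have h3 := Ideal.pow_right_mono hΦI n h2
    rw [← Ideal.map_pow, Ideal.map_quotient_self] at h3
    exact h3
  have : Module.Projective C T := projective_mvPolynomial_quotient_pow n
  exact projective_quotient_of_factor ((I ^ n).restrictScalars C) Φ.toLinearMap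
    (Ψ.toLinearMap : T →ₗ[C] C ⊗[K] C ⧸ I ^ n) hΦ hsurj (fun s hs => (hker' s).1 hs)

/-- Linear functionals on a power of the ideal of the diagonal of a smooth algebra extend. -/
theorem exists_extend_of_ideal_pow {K C : Type*} [CommRing K] [CommRing C] [Algebra K C]
    [Algebra.FormallySmooth K C] [Algebra.FiniteType K C] (n : ℕ)
    (η : ((KaehlerDifferential.ideal K C ^ n).restrictScalars C) →ₗ[C] C) :
    ∃ ζ : C ⊗[K] C →ₗ[C] C, ∀ x, ζ x.1 = η x := by
  let N := (KaehlerDifferential.ideal K C ^ n).restrictScalars C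
  have := projective_principalParts K C n
  have : Module.Projective C (C ⊗[K] C ⧸ N) := this
  obtain ⟨i, hi⟩ := Module.projective_lifting_property N.mkQ LinearMap.id N.mkQ_surjective
  -- `p` is the projection onto `N` along the image of the section `i`.
  let p : C ⊗[K] C →ₗ[C] N := (LinearMap.id - i ∘ₗ N.mkQ).codRestrict N (fun x => by
    rw [← Submodule.Quotient.mk_eq_zero, ← Submodule.mkQ_apply]
    have := LinearMap.congr_fun hi (N.mkQ x)
    simp only [LinearMap.comp_apply, LinearMap.id_apply] at this
    rw [LinearMap.sub_apply, map_sub, LinearMap.comp_apply, this, LinearMap.id_apply, sub_self])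
  refine ⟨η ∘ₗ p, fun x => ?_⟩
  have h0 : N.mkQ x.1 = 0 := (Submodule.Quotient.mk_eq_zero N).2 x.2
  have : p x.1 = x := by
    ext
    change x.1 - i (N.mkQ x.1) = x.1
    rw [h0, map_zero, sub_zero]
  rw [LinearMap.comp_apply, this]

end Projective

/-! ### Derivations into `End C` and the ideal of the diagonal -/

section Diagonal

/-- If `π` maps onto `P` and its kernel lies in the kernel of `Θ` then `Θ` factors through `π`. -/
theorem exists_factor_of_ker_le {A W P Q : Type*} [CommRing A] [AddCommGroup W] [Module A W]
    [AddCommGroup P] [Module A P] [AddCommGroup Q] [Module A Q] (π : W →ₗ[A] P) (Θ : W →ₗ[A] Q)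
    (hπ : Function.Surjective π) (h : ∀ w, π w = 0 → Θ w = 0) :
    ∃ η : P →ₗ[A] Q, ∀ w, η (π w) = Θ w := by
  let e := π.quotKerEquivOfSurjective hπ
  refine ⟨(LinearMap.ker π).liftQ Θ (fun w hw => h w hw) ∘ₗ e.symm.toLinearMap, fun w => ?_⟩
  have : e.symm (π w) = (LinearMap.ker π).mkQ w := by
    rw [LinearEquiv.symm_apply_eq]; rfl
  rw [LinearMap.comp_apply, LinearEquiv.coe_coe, this]
  rfl

theorem exists_factor_of_map_eq {A W P Q : Type*} [CommRing A] [AddCommGroup W] [Module A W]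
    [AddCommGroup P] [Module A P] [AddCommGroup Q] [Module A Q] (π : W →ₗ[A] P) (Θ : W →ₗ[A] Q)
    (W' : Submodule A W) (P' : Submodule A P) (hmap : W'.map π = P')
    (h : ∀ w ∈ W', π w = 0 → Θ w = 0) :
    ∃ η : P' →ₗ[A] Q, ∀ w ∈ W', ∀ x : P', x.1 = π w → η x = Θ w := by
  subst hmap
  obtain ⟨η, hη⟩ := exists_factor_of_ker_le (π.submoduleMap W') (Θ ∘ₗ W'.subtype)
    (π.submoduleMap_surjective W') (fun w hw => h w.1 w.2 (congrArg Subtype.val hw))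
  refine ⟨η, fun w hw x hx => ?_⟩
  have : x = π.submoduleMap W' ⟨w, hw⟩ := Subtype.ext hx
  rw [this, hη]
  rfl

variable {K C : Type*} [Field K] [CommRing C] [Algebra K C]

/-- The extension of a derivation modulo functionals that vanish on `I ^ N` from `C` to `C ⊗ C`
is linear over `C ⊗ C` on the ideal `I` of the diagonal. -/
theorem liftBaseChange_mul_of_derivation_mod (Γ : C →ₗ[K] (C ⊗[K] C →ₗ[C] C)) (N : ℕ)
    (hΓ : ∀ a b, ∀ u ∈ KaehlerDifferential.ideal K C ^ N,
      Γ (a * b) u = Γ a ((1 ⊗ₜ b) * u) + a * Γ b u)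
    (s t : C ⊗[K] C) (ht : t ∈ KaehlerDifferential.ideal K C)
    (u : C ⊗[K] C) (hu : u ∈ KaehlerDifferential.ideal K C ^ N) :
    Γ.liftBaseChange C (s * t) u = Γ.liftBaseChange C t (s * u) := by
  -- The defect of linearity is `lmul' K t * Γ b u`, which vanishes for `t` in `I`, the kernel of
  -- multiplication.
  have h1 (b : C) (t : C ⊗[K] C) : Γ.liftBaseChange C ((1 ⊗ₜ b) * t) u =
      Γ.liftBaseChange C t ((1 ⊗ₜ b) * u) + Algebra.TensorProduct.lmul' K t * Γ b u := by
    induction t with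
    | zero => simp
    | tmul x c =>
      simp only [Algebra.TensorProduct.tmul_mul_tmul, one_mul, LinearMap.liftBaseChange_tmul,
        LinearMap.smul_apply, smul_eq_mul, Algebra.TensorProduct.lmul'_apply_tmul]
      rw [mul_comm b c, hΓ c b u hu]
      ring
    | add x y hx hy =>
      simp only [mul_add, map_add, LinearMap.add_apply, hx, hy, add_mul]
      ring
  induction s with
  | zero => simp
  | tmul x y =>
    have e : x ⊗ₜ[K] y = x • ((1 : C) ⊗ₜ[K] y) := by simp [TensorProduct.smul_tmul']
    have h0 : Algebra.TensorProduct.lmul' K t = 0 := ht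
    rw [e, smul_mul_assoc, smul_mul_assoc, map_smul, map_smul, LinearMap.smul_apply, h1, h0,
      zero_mul, add_zero]
  | add x y hx hy => simp only [add_mul, map_add, LinearMap.add_apply, hx, hy]

/-- A consequence of the Artin-Rees lemma: a pairing of `I` and a high power `I ^ M` that is balanced
over `S` on `I ^ N` factors through the product of the two ideals. -/
theorem exists_factor_ideal_pow {A S Q : Type*} [CommRing A] [CommRing S] [Algebra A S]
    [IsNoetherianRing S] [AddCommGroup Q] [Module A Q] (I : Ideal S) (N : ℕ)
    (G : S →ₗ[A] (S →ₗ[A] Q))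
    (hG : ∀ s, ∀ t ∈ I, ∀ u ∈ I ^ N, G (s * t) u = G t (s * u)) :
    ∃ (M : ℕ) (η : (I ^ (M + 1)).restrictScalars A →ₗ[A] Q), N ≤ M ∧
      ∀ t ∈ I, ∀ u ∈ I ^ M, ∀ x, x.1 = t * u → η x = G t u := by
  obtain ⟨r, g, hg⟩ := Submodule.fg_iff_exists_fin_generating_family.1 (IsNoetherian.noetherian I)
  have hgI (i) : g i ∈ I := hg ▸ Submodule.subset_span ⟨i, rfl⟩
  let π : (Fin r → S) →ₗ[S] S := Fintype.linearCombination S g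
  have hπ (u) : π u = ∑ i, u i * g i := by simp [π, Fintype.linearCombination_apply]
  have hπr : LinearMap.range π = I := by
    rw [← hg]; exact Fintype.range_linearCombination S g
  let Θ : (Fin r → S) →ₗ[A] Q := ∑ i, G (g i) ∘ₗ LinearMap.proj (R := A) (φ := fun _ => S) i
  have hΘ (u) : Θ u = ∑ i, G (g i) (u i) := by simp [Θ]
  -- `k` is the Artin-Rees constant of the relations among the generators. With the exponent `N +
  -- k`, a factor `I ^ N` can be pulled out of the relations, which is just what balancing requires.
  obtain ⟨k, hk⟩ := Ideal.exists_pow_inf_eq_pow_smul I (LinearMap.ker π)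
  have hΘsmul (z : Fin r → S) (w : S) (hw : w ∈ I ^ N) : Θ (w • z) = G (π z) w := by
    rw [hΘ, hπ, map_sum, LinearMap.sum_apply]
    refine Finset.sum_congr rfl fun i _ => ?_
    rw [hG _ _ (hgI i) _ hw, Pi.smul_apply, smul_eq_mul, mul_comm]
  -- Such a `u` is a sum of `w • z` with `w ∈ I ^ N` and `π z = 0`, where `Θ (w • z) = G (π z) w =
  -- 0`.
  have hker : ∀ u ∈ (I ^ (N + k) • ⊤ : Submodule S (Fin r → S)), π u = 0 → Θ u = 0 := by
    intro u hu hu0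
    have h1 : u ∈ I ^ (N + k) • ⊤ ⊓ LinearMap.ker π := ⟨hu, hu0⟩
    rw [hk (N + k) (Nat.le_add_left _ _), Nat.add_sub_cancel] at h1
    refine Submodule.smul_induction_on h1 (fun w hw z hz => ?_) (fun x y hx hy => ?_)
    · rw [hΘsmul z w hw, LinearMap.mem_ker.1 hz.2]; simp
    · rw [map_add, hx, hy, add_zero]
  have hmap : (I ^ (N + k) • ⊤ : Submodule S (Fin r → S)).map π = I ^ (N + k + 1) := by
    rw [Submodule.map_smul'', ← LinearMap.range_eq_map, hπr, pow_succ, smul_eq_mul]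
  obtain ⟨η, hη⟩ := exists_factor_of_map_eq (A := A) (π.restrictScalars A) Θ
    ((I ^ (N + k) • ⊤ : Submodule S (Fin r → S)).restrictScalars A)
    ((I ^ (N + k + 1)).restrictScalars A) (congrArg (Submodule.restrictScalars A) hmap) hker
  refine ⟨N + k, η, Nat.le_add_right N k, fun t ht u hu x hx => ?_⟩
  rw [← hπr] at ht
  obtain ⟨s, rfl⟩ := ht
  rw [← hΘsmul s u (Ideal.pow_le_pow_right (Nat.le_add_right N k) hu)]
  have hus : u • s ∈ (I ^ (N + k) • ⊤ : Submodule S (Fin r → S)) :=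
    Submodule.smul_mem_smul hu Submodule.mem_top
  have hxs : x.1 = π (u • s) := by rw [hx, map_smul π, smul_eq_mul, mul_comm]
  exact hη (u • s) hus x hxs

/-- A derivation modulo functionals that vanish on a power of the ideal of the diagonal is inner
modulo functionals that vanish on a higher power. -/
theorem exists_inner_of_derivation_mod [Algebra.FormallySmooth K C] [Algebra.FiniteType K C]
    (Γ : C →ₗ[K] (C ⊗[K] C →ₗ[C] C)) (N : ℕ)
    (hΓ : ∀ a b, ∀ u ∈ KaehlerDifferential.ideal K C ^ N,
      Γ (a * b) u = Γ a ((1 ⊗ₜ b) * u) + a * Γ b u) :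
    ∃ (ζ : C ⊗[K] C →ₗ[C] C) (M : ℕ), ∀ a, ∀ u ∈ KaehlerDifferential.ideal K C ^ M,
      Γ a u = ζ ((1 ⊗ₜ a - a ⊗ₜ 1) * u) := by
  have : IsNoetherianRing C := Algebra.FiniteType.isNoetherianRing K C
  have : IsNoetherianRing (C ⊗[K] C) := Algebra.FiniteType.isNoetherianRing C (C ⊗[K] C)
  obtain ⟨M, η, hNM, hη⟩ := exists_factor_ideal_pow (KaehlerDifferential.ideal K C) N
    (Γ.liftBaseChange C) (liftBaseChange_mul_of_derivation_mod Γ N hΓ)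
  obtain ⟨ζ, hζ⟩ := exists_extend_of_ideal_pow (K := K) (M + 1) η
  refine ⟨ζ, M, fun a u hu => ?_⟩
  have hd := KaehlerDifferential.one_smul_sub_smul_one_mem_ideal K a
  have hmem : (1 ⊗ₜ a - a ⊗ₜ 1 : C ⊗[K] C) * u ∈
      (KaehlerDifferential.ideal K C ^ (M + 1)).restrictScalars C := by
    change _ ∈ KaehlerDifferential.ideal K C ^ (M + 1)
    rw [pow_succ']; exact Ideal.mul_mem_mul hd hu
  have h1 := hζ ⟨_, hmem⟩
  rw [hη _ hd u hu ⟨_, hmem⟩ rfl] at h1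
  rw [h1]
  -- A derivation kills `1`; this removes the contribution of `a ⊗ 1`.
  have h2 : Γ 1 u = 0 := by
    have h3 := hΓ 1 1 u (Ideal.pow_le_pow_right hNM hu)
    rw [one_mul, one_mul] at h3
    have e1 : (1 : C) ⊗ₜ[K] (1 : C) * u = u := one_mul u
    rw [e1] at h3
    simpa using h3
  simp [h2]

/-- Differential operators of order at most `n` on `C` are the linear maps whose extension to
`C ⊗ C` vanishes on the `n + 1`-st power of the ideal of the diagonal. -/
theorem isDiffOpOfOrder_id_iff (n : ℕ) (δ : C →ₗ[K] C) :
    IsDiffOpOfOrder (AlgHom.id K C) n δ ↔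
      ∀ u ∈ KaehlerDifferential.ideal K C ^ (n + 1), δ.liftBaseChange C u = 0 := by
  -- Up to sign, taking the commutator with `b` multiplies the argument by `1 ⊗ b - b ⊗ 1`. These
  -- elements span `I` over `C`, and order `0` already uses one commutator, hence the exponent `n +
  -- 1`.
  have hcomm (b : C) (δ : C →ₗ[K] C) (t : C ⊗[K] C) :
      (diffCommutator (AlgHom.id K C) b δ).liftBaseChange C t =
        - δ.liftBaseChange C (t * (1 ⊗ₜ b - b ⊗ₜ 1)) := by
    induction t with
    | zero => simp
    | tmul x y =>
      simp [mul_sub, diffCommutator, mul_comm y b]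
      ring
    | add x y hx hy => rw [map_add, hx, hy, add_mul, map_add]; ring
  have hspan (k : ℕ) (f : C ⊗[K] C →ₗ[C] C) :
      (∀ u ∈ KaehlerDifferential.ideal K C ^ (k + 1), f u = 0) ↔
      ∀ b : C, ∀ t ∈ KaehlerDifferential.ideal K C ^ k, f (t * (1 ⊗ₜ b - b ⊗ₜ 1)) = 0 := by
    constructor
    · intro h b t ht
      refine h _ ?_
      rw [pow_succ]
      exact Ideal.mul_mem_mul ht (KaehlerDifferential.one_smul_sub_smul_one_mem_ideal K b)
    · intro h u hu
      rw [pow_succ] at hu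
      refine Submodule.mul_induction_on hu (fun x hx y hy => ?_) (fun x y hx hy => ?_)
      · have : (KaehlerDifferential.ideal K C).restrictScalars C ≤
            LinearMap.ker (f ∘ₗ LinearMap.mulLeft C x) := by
          rw [← KaehlerDifferential.submodule_span_range_eq_ideal, Submodule.span_le]
          rintro _ ⟨b, rfl⟩
          exact h b x hx
        exact this hy
      · rw [map_add, hx, hy, add_zero]
  induction n generalizing δ with
  | zero =>
    rw [hspan, IsDiffOpOfOrder]
    refine forall_congr' fun b => ?_
    constructor
    · intro h t _
      rw [← neg_eq_zero, ← hcomm, h]; simp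
    · intro h
      ext y
      have := hcomm b δ (1 ⊗ₜ y)
      rw [h _ (by simp)] at this
      simpa using this
  | succ n ih =>
    rw [hspan, IsDiffOpOfOrder]
    refine forall_congr' fun b => (ih _).trans (forall₂_congr fun t _ => ?_)
    rw [hcomm, neg_eq_zero]

/-- A linear map from `C` to `End C` that is a derivation modulo differential operators of bounded
order is inner modulo differential operators of bounded order. -/
theorem exists_inner_mod_diffOp [Algebra.FormallySmooth K C] [Algebra.FiniteType K C]
    (γ : C →ₗ[K] C →ₗ[K] C) (N : ℕ)
    (hγ : ∀ a b, IsDiffOpOfOrder (AlgHom.id K C) N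
      (γ (a * b) - γ a ∘ₗ LinearMap.mulLeft K b - LinearMap.mulLeft K a ∘ₗ γ b)) :
    ∃ (η : C →ₗ[K] C) (M : ℕ), η 1 = 0 ∧
      ∀ a, IsDiffOpOfOrder (AlgHom.id K C) M (γ a - diffCommutator (AlgHom.id K C) a η) := by
  let Γ : C →ₗ[K] (C ⊗[K] C →ₗ[C] C) :=
    ((LinearMap.liftBaseChangeEquiv C).restrictScalars K).toLinearMap ∘ₗ γ
  have hΓ' (a : C) : Γ a = (γ a).liftBaseChange C := rfl
  obtain ⟨ζ, M, h⟩ := exists_inner_of_derivation_mod Γ (N + 1) (by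
    intro a b u hu
    have h1 := (isDiffOpOfOrder_id_iff N _).1 (hγ a b) u hu
    have h2 (u : C ⊗[K] C) : (γ (a * b) - γ a ∘ₗ LinearMap.mulLeft K b -
        LinearMap.mulLeft K a ∘ₗ γ b).liftBaseChange C u =
        Γ (a * b) u - Γ a ((1 ⊗ₜ b) * u) - a * Γ b u := by
      induction u with
      | zero => simp
      | tmul x y =>
        simp [hΓ']
        ring
      | add x y hx hy =>
        rw [map_add, hx, hy]
        simp only [mul_add, map_add]
        ring
    rw [h2, sub_sub, sub_eq_zero] at h1
    exact h1)
  -- The sign is chosen so that the commutator of `a` with `η₀` corresponds to `u ↦ ζ ((1 ⊗ a - a ⊗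
  -- 1) * u)`.
  let η₀ : C →ₗ[K] C := -(ζ.restrictScalars K ∘ₗ Algebra.TensorProduct.includeRight.toLinearMap)
  have hη₀ (y : C) : η₀ y = - ζ (1 ⊗ₜ y) := rfl
  -- Subtracting a multiplication operator normalizes `η` without changing any commutator.
  refine ⟨η₀ - LinearMap.mulLeft K (η₀ 1), M, by simp, fun a => ?_⟩
  refine (isDiffOpOfOrder_id_iff M _).2 fun u hu => ?_
  have h3 (u : C ⊗[K] C) : (γ a - diffCommutator (AlgHom.id K C) a
      (η₀ - LinearMap.mulLeft K (η₀ 1))).liftBaseChange C u =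
      Γ a u - ζ ((1 ⊗ₜ a - a ⊗ₜ 1) * u) := by
    induction u with
    | zero => simp
    | tmul x y =>
      have e1 (x y : C) : ζ (x ⊗ₜ y) = x * ζ (1 ⊗ₜ y) := by
        have : x ⊗ₜ[K] y = x • ((1 : C) ⊗ₜ[K] y) := by simp [TensorProduct.smul_tmul']
        rw [this, map_smul, smul_eq_mul]
      simp [hΓ', diffCommutator, hη₀, sub_mul, e1 x, e1 (a * x)]
      ring
    | add x y hx hy =>
      rw [map_add, hx, hy]
      simp only [mul_add, map_add]
      ring
  rw [h3, h a u (Ideal.pow_le_pow_right (Nat.le_succ M) hu), sub_self]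

end Diagonal

/-! ### Calculus of differential operators -/

section Calculus

variable {K B B' C : Type*} [Field K] [CommRing B] [Algebra K B] [CommRing B'] [Algebra K B']
  [CommRing C] [Algebra K C]

theorem IsDiffOpOfOrder.neg {f : B →ₐ[K] C} {n : ℕ} {φ : B →ₗ[K] C}
    (h : IsDiffOpOfOrder f n φ) : IsDiffOpOfOrder f n (-φ) := by
  have e : -φ = (-1 : K) • φ := by ext x; simp
  rw [e]
  exact h.smul (-1)

theorem IsDiffOpOfOrder.sub {f : B →ₐ[K] C} {n : ℕ} {φ ψ : B →ₗ[K] C}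
    (h : IsDiffOpOfOrder f n φ) (h' : IsDiffOpOfOrder f n ψ) : IsDiffOpOfOrder f n (φ - ψ) := by
  simpa [sub_eq_add_neg] using h.add h'.neg

theorem diffCommutator_apply (f : B →ₐ[K] C) (b : B) (φ : B →ₗ[K] C) (x : B) :
    diffCommutator f b φ x = f b * φ x - φ (b * x) := rfl

theorem diffCommutator_comp (f : B →ₐ[K] B') (g : B' →ₐ[K] C) (b : B) (φ : B →ₗ[K] B')
    (ψ : B' →ₗ[K] C) : diffCommutator (g.comp f) b (ψ ∘ₗ φ) =
      diffCommutator g (f b) ψ ∘ₗ φ + ψ ∘ₗ diffCommutator f b φ := by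
  ext x; simp [diffCommutator_apply]

theorem diffCommutator_add_left (f : B →ₐ[K] C) (b b' : B) (φ : B →ₗ[K] C) :
    diffCommutator f (b + b') φ = diffCommutator f b φ + diffCommutator f b' φ := by
  ext x; simp [diffCommutator_apply, add_mul]; ring

theorem diffCommutator_zero_left (f : B →ₐ[K] C) (φ : B →ₗ[K] C) :
    diffCommutator f 0 φ = 0 := by
  ext x; simp [diffCommutator_apply]

theorem diffCommutator_mul_left (f : B →ₐ[K] C) (b b' : B) (φ : B →ₗ[K] C) :
    diffCommutator f (b * b') φ = LinearMap.mulLeft K (f b) ∘ₗ diffCommutator f b' φ +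
      diffCommutator f b φ ∘ₗ LinearMap.mulLeft K b' := by
  ext x; simp [diffCommutator_apply, mul_assoc, mul_sub]

theorem diffCommutator_comm (f : B →ₐ[K] C) (b b' : B) (φ : B →ₗ[K] C) :
    diffCommutator f b (diffCommutator f b' φ) = diffCommutator f b' (diffCommutator f b φ) := by
  ext x; simp [diffCommutator_apply, mul_left_comm b b']; ring

/-- The commutator with `b` is a derivation for composition, so each summand has a factor of smaller
order, or vanishes if that factor had order `0`. -/
theorem IsDiffOpOfOrder.comp {f : B →ₐ[K] B'} {g : B' →ₐ[K] C} {p q : ℕ} {φ : B →ₗ[K] B'}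
    {ψ : B' →ₗ[K] C} (hψ : IsDiffOpOfOrder g q ψ) (hφ : IsDiffOpOfOrder f p φ) :
    IsDiffOpOfOrder (g.comp f) (p + q) (ψ ∘ₗ φ) := by
  induction hn : p + q generalizing p q φ ψ with
  | zero =>
    obtain ⟨rfl, rfl⟩ := Nat.add_eq_zero_iff.1 hn
    intro b
    rw [diffCommutator_comp, hψ, hφ, LinearMap.zero_comp, LinearMap.comp_zero, add_zero]
  | succ n ih =>
    intro b
    rw [diffCommutator_comp]
    refine IsDiffOpOfOrder.add ?_ ?_
    · cases q with
      | zero => rw [hψ, LinearMap.zero_comp]; exact IsDiffOpOfOrder.zero _ _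
      | succ q => exact ih (hψ (f b)) hφ (by lia)
    · cases p with
      | zero => rw [hφ, LinearMap.comp_zero]; exact IsDiffOpOfOrder.zero _ _
      | succ p => exact ih hψ (hφ b) (by lia)

theorem isDiffOpOfOrder_algHom (f : B →ₐ[K] C) : IsDiffOpOfOrder f 0 f.toLinearMap := by
  intro b; ext x; simp [diffCommutator_apply]

theorem isDiffOpOfOrder_mulLeft (b : B) :
    IsDiffOpOfOrder (AlgHom.id K B) 0 (LinearMap.mulLeft K b) := by
  intro b'; ext x; simp [diffCommutator_apply, mul_left_comm]

theorem IsDiffOpOfOrder.mulLeft_comp {f : B →ₐ[K] C} {n : ℕ} {φ : B →ₗ[K] C}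
    (h : IsDiffOpOfOrder f n φ) (c : C) : IsDiffOpOfOrder f n (LinearMap.mulLeft K c ∘ₗ φ) :=
  (isDiffOpOfOrder_mulLeft (K := K) c).comp h

theorem IsDiffOpOfOrder.comp_mulLeft {f : B →ₐ[K] C} {n : ℕ} {φ : B →ₗ[K] C}
    (h : IsDiffOpOfOrder f n φ) (b : B) : IsDiffOpOfOrder f n (φ ∘ₗ LinearMap.mulLeft K b) :=
  (h.comp (isDiffOpOfOrder_mulLeft (K := K) b)).mono (by simp)

/-- It suffices to test commutators with pure tensors. -/
theorem isDiffOpOfOrder_succ_of_tmul {C' : Type*} [CommRing C'] [Algebra K C']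
    {f : B ⊗[K] B' →ₐ[K] C'} {n : ℕ}
    {φ : B ⊗[K] B' →ₗ[K] C'} (h : ∀ b b', IsDiffOpOfOrder f n (diffCommutator f (b ⊗ₜ b') φ)) :
    IsDiffOpOfOrder f (n + 1) φ := by
  intro t
  induction t with
  | zero => rw [diffCommutator_zero_left]; exact IsDiffOpOfOrder.zero _ _
  | tmul b b' => exact h b b'
  | add x y hx hy => rw [diffCommutator_add_left]; exact hx.add hy

theorem diffCommutator_rTensor (φ : C →ₗ[K] C) (b : C) (b' : B) :
    diffCommutator (AlgHom.id K (C ⊗[K] B)) (b ⊗ₜ b') (φ.rTensor B) =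
      LinearMap.mulLeft K (1 ⊗ₜ b') ∘ₗ (diffCommutator (AlgHom.id K C) b φ).rTensor B := by
  ext x y
  simp [diffCommutator_apply, TensorProduct.sub_tmul, mul_sub]

theorem IsDiffOpOfOrder.rTensor {n : ℕ} {φ : C →ₗ[K] C}
    (h : IsDiffOpOfOrder (AlgHom.id K C) n φ) :
    IsDiffOpOfOrder (AlgHom.id K (C ⊗[K] B)) n (φ.rTensor B) := by
  induction n generalizing φ with
  | zero =>
    intro t
    induction t with
    | zero => rw [diffCommutator_zero_left]
    | tmul b b' => rw [diffCommutator_rTensor, h b, LinearMap.rTensor_zero, LinearMap.comp_zero]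
    | add x y hx hy => rw [diffCommutator_add_left, hx, hy, add_zero]
  | succ n ih =>
    refine isDiffOpOfOrder_succ_of_tmul fun b b' => ?_
    rw [diffCommutator_rTensor]
    exact (ih (h b)).mulLeft_comp _

end Calculus

/-! ### Hochschild cochains with differential coboundary -/

section Hochschild

variable {K C : Type*} [Field K] [CommRing C] [Algebra K C]

local notation "μ" => Algebra.TensorProduct.lmul' K (S := C)

/-- The Hochschild coboundary of a `1`-cochain. -/
noncomputable def coboundaryOne (η : C →ₗ[K] C) : C ⊗[K] C →ₗ[K] C :=
  (μ).toLinearMap ∘ₗ η.lTensor C - η ∘ₗ (μ).toLinearMap + (μ).toLinearMap ∘ₗ η.rTensor C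

/-- The Hochschild coboundary of a `2`-cochain, evaluated at a first argument. -/
noncomputable def coboundaryTwo (γ : C ⊗[K] C →ₗ[K] C) (a : C) : C ⊗[K] C →ₗ[K] C :=
  LinearMap.mulLeft K a ∘ₗ γ - γ ∘ₗ LinearMap.mulLeft K (a ⊗ₜ 1) +
    TensorProduct.curry γ a ∘ₗ (μ).toLinearMap -
      (μ).toLinearMap ∘ₗ (TensorProduct.curry γ a).rTensor C

@[simp]
theorem coboundaryOne_tmul (η : C →ₗ[K] C) (a b : C) :
    coboundaryOne η (a ⊗ₜ b) = a * η b - η (a * b) + η a * b := by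
  simp [coboundaryOne]

@[simp]
theorem coboundaryTwo_tmul (γ : C ⊗[K] C →ₗ[K] C) (a b c : C) :
    coboundaryTwo γ a (b ⊗ₜ c) =
      a * γ (b ⊗ₜ c) - γ ((a * b) ⊗ₜ c) + γ (a ⊗ₜ (b * c)) - γ (a ⊗ₜ b) * c := by
  simp [coboundaryTwo]

/-- The identity `d ∘ d = 0` of the Hochschild complex. -/
theorem coboundaryTwo_sub_coboundaryOne (γ : C ⊗[K] C →ₗ[K] C) (η : C →ₗ[K] C) (a : C) :
    coboundaryTwo (γ - coboundaryOne η) a = coboundaryTwo γ a := by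
  ext b c
  simp [mul_assoc]
  ring

/-- Fixing the first argument is precomposition with multiplication by `a ⊗ 1` and with an algebra
map, both of order `0`; hence the bound does not depend on `a`. -/
theorem IsDiffOpOfOrder.curry {n : ℕ} {φ : C ⊗[K] C →ₗ[K] C}
    (h : IsDiffOpOfOrder (μ) n φ) (a : C) :
    IsDiffOpOfOrder (AlgHom.id K C) n (TensorProduct.curry φ a) := by
  have h1 := (h.comp_mulLeft (a ⊗ₜ 1)).comp
    (isDiffOpOfOrder_algHom (Algebra.TensorProduct.includeRight : C →ₐ[K] C ⊗[K] C))
  have e1 : (μ).comp (Algebra.TensorProduct.includeRight : C →ₐ[K] C ⊗[K] C) = AlgHom.id K C := by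
    ext; simp
  have e2 : TensorProduct.curry φ a = (φ ∘ₗ LinearMap.mulLeft K (a ⊗ₜ 1)) ∘ₗ
      (Algebra.TensorProduct.includeRight : C →ₐ[K] C ⊗[K] C).toLinearMap := by
    ext; simp
  rw [e1, ← e2] at h1
  exact h1.mono (by simp)

/-- A family of `K`-linear maps `C ⊗ C → C` consists of differential operators of bounded order. -/
def IsUniformlyDiff (D : C → (C ⊗[K] C →ₗ[K] C)) : Prop :=
  ∃ N, ∀ a, IsDiffOpOfOrder (μ) N (D a)

theorem IsUniformlyDiff.zero : IsUniformlyDiff (fun _ : C => (0 : C ⊗[K] C →ₗ[K] C)) :=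
  ⟨0, fun _ => IsDiffOpOfOrder.zero _ _⟩

theorem IsUniformlyDiff.add {D D' : C → (C ⊗[K] C →ₗ[K] C)} (h : IsUniformlyDiff D)
    (h' : IsUniformlyDiff D') : IsUniformlyDiff (fun a => D a + D' a) := by
  obtain ⟨m, hm⟩ := h
  obtain ⟨n, hn⟩ := h'
  exact ⟨max m n, fun a => ((hm a).mono (le_max_left m n)).add ((hn a).mono (le_max_right m n))⟩

theorem IsUniformlyDiff.smul {D : C → (C ⊗[K] C →ₗ[K] C)} (k : K) (h : IsUniformlyDiff D) :
    IsUniformlyDiff (fun a => k • D a) := by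
  obtain ⟨m, hm⟩ := h
  exact ⟨m, fun a => (hm a).smul k⟩

theorem IsUniformlyDiff.sub {D D' : C → (C ⊗[K] C →ₗ[K] C)} (h : IsUniformlyDiff D)
    (h' : IsUniformlyDiff D') : IsUniformlyDiff (fun a => D a - D' a) := by
  obtain ⟨m, hm⟩ := h
  obtain ⟨n, hn⟩ := h'
  exact ⟨max m n, fun a => ((hm a).mono (le_max_left m n)).sub ((hn a).mono (le_max_right m n))⟩

theorem IsUniformlyDiff.sum {ι : Type*} (s : Finset ι) {D : ι → C → (C ⊗[K] C →ₗ[K] C)}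
    (h : ∀ i ∈ s, IsUniformlyDiff (D i)) : IsUniformlyDiff (fun a => ∑ i ∈ s, D i a) := by
  classical
  induction s using Finset.induction_on with
  | empty => simpa using IsUniformlyDiff.zero
  | insert i s hi ih =>
    simp only [Finset.sum_insert hi]
    exact (h i (Finset.mem_insert_self i s)).add (ih fun j hj => h j (Finset.mem_insert_of_mem hj))

/-- Orders add under composition, uniformly in `a`. These are the terms `ψ(a, φ(b, c))` of an
associator; the next lemma treats `ψ(φ(a, b), c)`. -/
theorem isUniformlyDiff_comp_right {φ ψ : C ⊗[K] C →ₗ[K] C} (hφ : IsDiffOp (μ) φ)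
    (hψ : IsDiffOp (μ) ψ) : IsUniformlyDiff (fun a => TensorProduct.curry ψ a ∘ₗ φ) := by
  obtain ⟨m, hm⟩ := hφ
  obtain ⟨n, hn⟩ := hψ
  exact ⟨m + n, fun a => (hn.curry a).comp hm⟩

theorem isUniformlyDiff_comp_left {φ ψ : C ⊗[K] C →ₗ[K] C} (hφ : IsDiffOp (μ) φ)
    (hψ : IsDiffOp (μ) ψ) :
    IsUniformlyDiff (fun a => ψ ∘ₗ (TensorProduct.curry φ a).rTensor C) := by
  obtain ⟨m, hm⟩ := hφ
  obtain ⟨n, hn⟩ := hψ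
  exact ⟨m + n, fun a => hn.comp (hm.curry a).rTensor⟩

theorem isUniformlyDiff_coboundaryTwo {φ : C ⊗[K] C →ₗ[K] C} (hφ : IsDiffOp (μ) φ) :
    IsUniformlyDiff (coboundaryTwo φ) := by
  have hμ : IsDiffOp (μ) (μ).toLinearMap := ⟨0, isDiffOpOfOrder_algHom _⟩
  have h1 : IsUniformlyDiff (fun a => LinearMap.mulLeft K a ∘ₗ φ) := by
    obtain ⟨n, hn⟩ := hφ
    exact ⟨n, fun a => hn.mulLeft_comp a⟩
  have h2 : IsUniformlyDiff (fun a => φ ∘ₗ LinearMap.mulLeft K (a ⊗ₜ[K] (1 : C))) := by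
    obtain ⟨n, hn⟩ := hφ
    exact ⟨n, fun a => hn.comp_mulLeft _⟩
  exact ((h1.sub h2).add (isUniformlyDiff_comp_right hμ hφ)).sub
    (isUniformlyDiff_comp_left hφ hμ)

/-- A cochain is a bidifferential operator if it is differential of bounded order in its second
argument, and its commutators with the first argument are bidifferential of bounded order. -/
theorem isDiffOpOfOrder_of_curry (p N : ℕ) (φ : C ⊗[K] C →ₗ[K] C)
    (h₂ : ∀ a, IsDiffOpOfOrder (AlgHom.id K C) p (TensorProduct.curry φ a))
    (h₁ : ∀ a, IsDiffOpOfOrder (μ) N (diffCommutator (μ) (a ⊗ₜ 1) φ)) :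
    IsDiffOpOfOrder (μ) (N + p + 1) φ := by
  induction p generalizing φ with
  | zero =>
    refine isDiffOpOfOrder_succ_of_tmul fun b b' => ?_
    have hb : b ⊗ₜ[K] b' = (1 ⊗ₜ[K] b') * (b ⊗ₜ[K] 1) := by simp
    have h0 : diffCommutator (μ) (1 ⊗ₜ b') φ = 0 := by
      ext x y
      simpa [diffCommutator_apply] using LinearMap.congr_fun (h₂ x b') y
    rw [hb, diffCommutator_mul_left, h0, LinearMap.zero_comp, add_zero]
    exact (h₁ b).mulLeft_comp _
  | succ p ih =>
    refine isDiffOpOfOrder_succ_of_tmul fun b b' => ?_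
    -- The commutator with `b ⊗ 1` is controlled by `h₁`, while the one with `1 ⊗ b'` lowers the
    -- order `p` in the second argument. Commutators commute, so `h₁` survives the induction.
    have hb : b ⊗ₜ[K] b' = (1 ⊗ₜ[K] b') * (b ⊗ₜ[K] 1) := by simp
    rw [hb, diffCommutator_mul_left]
    refine IsDiffOpOfOrder.add (((h₁ b).mulLeft_comp _).mono (by lia)) ?_
    refine IsDiffOpOfOrder.comp_mulLeft (ih _ (fun a => ?_) (fun a => ?_)) _
    · have e : TensorProduct.curry (diffCommutator (μ) (1 ⊗ₜ b') φ) a =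
          diffCommutator (AlgHom.id K C) b' (TensorProduct.curry φ a) := by
        ext y; simp [diffCommutator_apply]
      rw [e]
      exact h₂ a b'
    · rw [diffCommutator_comm]
      have h3 := (h₁ a).succ (1 ⊗ₜ b')
      exact h3

/-- A normalized Hochschild `2`-cochain of a smooth algebra whose coboundary is differential is
cohomologous to a normalized bidifferential operator. -/
theorem exists_sub_coboundaryOne_mem [Algebra.FormallySmooth K C] [Algebra.FiniteType K C]
    (γ : C ⊗[K] C →ₗ[K] C) (h1 : ∀ c, γ (1 ⊗ₜ c) = 0 ∧ γ (c ⊗ₜ 1) = 0)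
    (hγ : IsUniformlyDiff (coboundaryTwo γ)) :
    ∃ η : C →ₗ[K] C, η 1 = 0 ∧ γ - coboundaryOne η ∈ NormalizedBiDiffOp K C := by
  obtain ⟨N, hN⟩ := hγ
  obtain ⟨η, M, hη, hM⟩ := exists_inner_mod_diffOp (TensorProduct.curry γ) N (fun a b => by
    -- The formula for `dγ(a, b, c)`, read as an operator in `c`: the failure of `a ↦ γ(a, -)` to be
    -- a derivation is `-dγ(a, b, -)` minus multiplication by `γ(a, b)`.
    have e : TensorProduct.curry γ (a * b) - TensorProduct.curry γ a ∘ₗ LinearMap.mulLeft K b -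
        LinearMap.mulLeft K a ∘ₗ TensorProduct.curry γ b =
        - TensorProduct.curry (coboundaryTwo γ a) b - LinearMap.mulLeft K (γ (a ⊗ₜ b)) := by
      ext c; simp; ring
    rw [e]
    exact ((hN a).curry b).neg.sub ((isDiffOpOfOrder_mulLeft _).mono (Nat.zero_le N)))
  set γ' := γ - coboundaryOne η
  have hcurry (a : C) : IsDiffOpOfOrder (AlgHom.id K C) M (TensorProduct.curry γ' a) := by
    have e : TensorProduct.curry γ' a = (TensorProduct.curry γ a -
        diffCommutator (AlgHom.id K C) a η) - LinearMap.mulLeft K (η a) := by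
      ext c; simp [γ', diffCommutator_apply]; ring
    rw [e]
    exact (hM a).sub ((isDiffOpOfOrder_mulLeft _).mono (Nat.zero_le M))
  refine ⟨η, hη, fun c => ⟨by simp [h1, hη], by simp [h1, hη]⟩, max N M + M + 1,
    isDiffOpOfOrder_of_curry M (max N M) γ' hcurry fun a => ?_⟩
  -- The same formula solved for `a γ'(b, c) - γ'(ab, c)`, using `dγ' = dγ`. On the right `γ'`
  -- occurs only with `a` as its first argument, where it is already differential.
  have e : diffCommutator (μ) (a ⊗ₜ 1) γ' = coboundaryTwo γ a -
      TensorProduct.curry γ' a ∘ₗ (μ).toLinearMap +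
        (μ).toLinearMap ∘ₗ (TensorProduct.curry γ' a).rTensor C := by
    rw [← coboundaryTwo_sub_coboundaryOne γ η a]
    ext b c
    simp [diffCommutator_apply, -coboundaryOne_tmul, γ']
    ring
  rw [e]
  refine IsDiffOpOfOrder.add (((hN a).mono (le_max_left _ _)).sub ?_) ?_
  · exact ((hcurry a).comp (isDiffOpOfOrder_algHom (μ))).mono (by simp)
  · exact ((isDiffOpOfOrder_algHom (μ)).comp (hcurry a).rTensor).mono (by simp)

end Hochschild

/-! ### Graded pieces of the parameter algebra -/

section Parameter

variable (K R : Type*) [Field K] [CommRing R] [Algebra K R] [IsLocalRing R]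

theorem maximalIdeal_fg [IsParameterAlgebra K R] : (maximalIdeal R).FG :=
  (IsParameterAlgebra.isNoetherianRing (K := K) (R := R)).noetherian _

variable [IsParameterAlgebra K R]

variable {R} in
theorem sub_augmentation_mem (r : R) :
    r - algebraMap K R (augmentation K R r) ∈ maximalIdeal R := by
  rw [← residue_eq_zero_iff, map_sub, sub_eq_zero]
  have h : residue R (algebraMap K R (augmentation K R r)) =
      algebraMap K (ResidueField R) (augmentation K R r) :=
    (IsScalarTower.algebraMap_apply K R (ResidueField R) _).symm
  rw [h]
  exact ((RingEquiv.ofBijective (algebraMap K (ResidueField R))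
    (IsParameterAlgebra.bijective_residue (K := K) (R := R))).apply_symm_apply (residue R r)).symm

/-- Dual bases of the finite-dimensional space `𝔪 ^ n / 𝔪 ^ (n + 1)`. -/
theorem exists_dual_basis_pow (n : ℕ) :
    ∃ (d : ℕ) (t : Fin d → R) (l : Fin d → (R →ₗ[K] K)),
      (∀ i, t i ∈ maximalIdeal R ^ n) ∧ (∀ i, ∀ r ∈ maximalIdeal R ^ (n + 1), l i r = 0) ∧
      (∀ i j, l i (t j) = if i = j then 1 else 0) ∧
      ∀ r ∈ maximalIdeal R ^ n, r - ∑ i, algebraMap K R (l i r) * t i ∈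
        maximalIdeal R ^ (n + 1) := by
  have := IsParameterAlgebra.isNoetherianRing (K := K) (R := R)
  let P : Submodule K R := (maximalIdeal R ^ n).restrictScalars K
  let Q : Submodule K R := (maximalIdeal R ^ (n + 1)).restrictScalars K
  let W : Submodule K (R ⧸ Q) := P.map Q.mkQ
  -- `R` acts on `𝔪 ^ n / 𝔪 ^ (n + 1)` through its augmentation to `K`, so generators over `R` also
  -- span over `K`.
  have hfin : Module.Finite K W := by
    rw [Module.Finite.iff_fg]
    obtain ⟨S, hS⟩ := (IsNoetherian.noetherian (maximalIdeal R ^ n) : (maximalIdeal R ^ n).FG)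
    classical
    refine ⟨S.image Q.mkQ, le_antisymm ?_ ?_⟩
    · rw [Submodule.span_le]
      intro x hx
      obtain ⟨s, hs, rfl⟩ := Finset.mem_image.1 (Finset.mem_coe.1 hx)
      refine Submodule.mem_map_of_mem ?_
      change s ∈ maximalIdeal R ^ n
      rw [← hS]; exact Submodule.subset_span hs
    · rintro _ ⟨r, hr, rfl⟩
      have hr' : r ∈ maximalIdeal R ^ n := hr
      rw [← hS] at hr'
      induction hr' using Submodule.span_induction with
      | mem x hx =>
        exact Submodule.subset_span (Finset.mem_coe.2 (Finset.mem_image_of_mem _ hx))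
      | zero => simp
      | add x y hx hy h1 h2 =>
        rw [map_add]
        exact Submodule.add_mem _ (h1 (hS ▸ hx :)) (h2 (hS ▸ hy :))
      | smul a x hx h =>
        have hx' : x ∈ maximalIdeal R ^ n := hS ▸ hx
        have e : Q.mkQ (a • x) = augmentation K R a • Q.mkQ x := by
          rw [← map_smul, ← sub_eq_zero, ← map_sub, ← LinearMap.mem_ker, Submodule.ker_mkQ]
          change _ ∈ maximalIdeal R ^ (n + 1)
          rw [smul_eq_mul, Algebra.smul_def, ← sub_mul, pow_succ']
          exact Ideal.mul_mem_mul (sub_augmentation_mem K a) hx'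
        rw [e]
        exact Submodule.smul_mem _ _ (h hx')
  let b := Module.finBasis K W
  have ht (i) : ∃ t ∈ P, Q.mkQ t = (b i : R ⧸ Q) := (b i).2
  choose t htP htb using ht
  have hl (i) : ∃ l : (R ⧸ Q) →ₗ[K] K, l ∘ₗ W.subtype = b.coord i := LinearMap.exists_extend _
  choose l hl using hl
  have hl' (i) (w : W) : l i w = b.coord i w := LinearMap.congr_fun (hl i) w
  refine ⟨_, t, fun i => l i ∘ₗ Q.mkQ, htP, fun i r hr => ?_, fun i j => ?_, fun r hr => ?_⟩
  · have : Q.mkQ r = 0 := (Submodule.Quotient.mk_eq_zero Q).2 hr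
    rw [LinearMap.comp_apply, this, map_zero]
  · rw [LinearMap.comp_apply, htb, hl', b.coord_apply, b.repr_self, Finsupp.single_apply]
    simp only [eq_comm]
  · change _ ∈ Q
    rw [← Submodule.Quotient.mk_eq_zero Q, ← Submodule.mkQ_apply, map_sub, sub_eq_zero, map_sum]
    let w : W := ⟨Q.mkQ r, Submodule.mem_map_of_mem hr⟩
    have h1 := congrArg Subtype.val (b.sum_repr w)
    have h2 (i) : Q.mkQ (algebraMap K R ((l i ∘ₗ Q.mkQ) r) * t i) = b.repr w i • (b i : R ⧸ Q) := by
      rw [← Algebra.smul_def, map_smul, htb]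
      congr 1
      exact hl' i w
    simp only [h2]
    have h3 : Q.mkQ r = (w : R ⧸ Q) := rfl
    rw [h3]
    exact h1.symm.trans (AddSubmonoidClass.coe_finsetSum _ _)

end Parameter

/-! ### Slices of tensors by functionals on `R` -/

section Slice

variable {K R : Type*} [Field K] [CommRing R] [Algebra K R]
variable {V W : Type*} [AddCommGroup V] [Module K V] [AddCommGroup W] [Module K W]

/-- The map `R ⊗ V → V` induced by a linear functional on `R`. -/
noncomputable def slice (V : Type*) [AddCommGroup V] [Module K V] (l : R →ₗ[K] K) :
    R ⊗[K] V →ₗ[K] V :=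
  (TensorProduct.lid K V).toLinearMap ∘ₗ l.rTensor V

@[simp]
theorem slice_tmul (l : R →ₗ[K] K) (r : R) (v : V) : slice V l (r ⊗ₜ v) = l r • v := by
  simp [slice]

theorem slice_baseChange (l : R →ₗ[K] K) (f : V →ₗ[K] W) (x : R ⊗[K] V) :
    slice W l (f.baseChange R x) = f (slice V l x) := by
  induction x with
  | zero => simp
  | tmul r v => simp
  | add x y hx hy => simp only [map_add, hx, hy]

theorem slice_eq_zero (I : Ideal R) (l : R →ₗ[K] K) (hl : ∀ r ∈ I, l r = 0) (x : R ⊗[K] V)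
    (hx : x ∈ (I • ⊤ : Submodule R (R ⊗[K] V))) : slice V l x = 0 := by
  refine Submodule.smul_induction_on hx (fun r hr y hy => ?_) (fun x y hx hy => ?_)
  · clear hy
    induction y with
    | zero => simp
    | tmul s v =>
      rw [TensorProduct.smul_tmul', slice_tmul, smul_eq_mul, hl _ (Ideal.mul_mem_right _ _ hr),
        zero_smul]
    | add x y hx hy => rw [smul_add, map_add, hx, hy, add_zero]
  · rw [map_add, hx, hy, add_zero]

theorem tmul_mem_smul_top (I : Ideal R) {r : R} (hr : r ∈ I) (v : V) :
    r ⊗ₜ[K] v ∈ (I • ⊤ : Submodule R (R ⊗[K] V)) := by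
  have : r ⊗ₜ[K] v = r • ((1 : R) ⊗ₜ[K] v) := by
    rw [TensorProduct.smul_tmul', smul_eq_mul, mul_one]
  rw [this]
  exact Submodule.smul_mem_smul hr trivial

/-- Membership in `I (R ⊗ V)` is detected by the functionals on `R` that vanish on `I`. -/
theorem mem_smul_top_of_slice_eq_zero (I : Ideal R) (x : R ⊗[K] V)
    (h : ∀ l : R →ₗ[K] K, (∀ r ∈ I, l r = 0) → slice V l x = 0) :
    x ∈ (I • ⊤ : Submodule R (R ⊗[K] V)) := by
  classical
  -- In coordinates on `V`, a coefficient outside `I` would be detected by a functional that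
  -- vanishes on `I`.
  let b := Module.Basis.ofVectorSpace K V
  let c := TensorProduct.equivFinsuppOfBasisRight (M := R) b x
  have hx : x = c.sum fun i r => r ⊗ₜ b i := by
    rw [← TensorProduct.equivFinsuppOfBasisRight_symm_apply]
    exact (LinearEquiv.symm_apply_apply _ x).symm
  have hc (i) : c i ∈ I := by
    by_contra hi
    obtain ⟨l, hl, hlI⟩ := Submodule.exists_le_ker_of_notMem (p := I.restrictScalars K) hi
    have h1 := h l (fun r hr => hlI hr)
    rw [hx, Finsupp.sum, map_sum] at h1
    simp only [slice_tmul] at h1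
    have h2 := linearIndependent_iff'.1 b.linearIndependent c.support (fun i => l (c i)) h1
    by_cases hs : i ∈ c.support
    · exact hl (h2 i hs)
    · rw [Finsupp.notMem_support_iff] at hs
      exact hi (hs ▸ I.zero_mem)
  rw [hx]
  refine Submodule.sum_mem _ fun i _ => ?_
  exact tmul_mem_smul_top I (hc i) (b i)

end Slice

/-! ### The `𝔪`-adic filtration of completed tensor products -/

section Completion

variable {K R : Type*} [Field K] [CommRing R] [Algebra K R] [IsLocalRing R]
variable {V W : Type*} [AddCommGroup V] [Module K V] [AddCommGroup W] [Module K W]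

theorem incl_add (v w : V) : incl K R (v + w) = incl K R v + incl K R w := by
  simp [incl, TensorProduct.tmul_add]

theorem incl_smul (k : K) (v : V) : incl K R (k • v) = algebraMap K R k • incl K R v := by
  rw [incl, incl, ← map_smul, TensorProduct.smul_tmul', TensorProduct.tmul_smul,
    TensorProduct.smul_tmul', smul_eq_mul, mul_one, Algebra.algebraMap_eq_smul_one]

theorem of_tmul (r : R) (v : V) :
    AdicCompletion.of (maximalIdeal R) (R ⊗[K] V) (r ⊗ₜ v) = r • incl K R v := by
  rw [incl, ← map_smul, TensorProduct.smul_tmul', smul_eq_mul, mul_one]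

variable (R) in
/-- The `R`-linear extension of a linear map to completed tensor products, as a linear map. -/
noncomputable def completedLinearMap (f : V →ₗ[K] W) :
    CompletedTensor K R V →ₗ[R] CompletedTensor K R W :=
  (AdicCompletion.map (maximalIdeal R) (f.baseChange R)).restrictScalars R

theorem completedLinearMap_incl (f : V →ₗ[K] W) (v : V) :
    completedLinearMap R f (incl K R v) = incl K R (f v) := by
  change AdicCompletion.map (maximalIdeal R) (f.baseChange R) _ = _
  rw [incl, AdicCompletion.map_of]
  rfl

theorem completedMap_eval (f : V →ₗ[K] W) (n : ℕ) (x : CompletedTensor K R V) (y : R ⊗[K] V)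
    (h : AdicCompletion.eval (maximalIdeal R) (R ⊗[K] V) n x = Submodule.mkQ _ y) :
    AdicCompletion.eval (maximalIdeal R) (R ⊗[K] W) n (completedMap K R f x) =
      Submodule.mkQ _ (f.baseChange R y) := by
  rw [completedMap, AdicCompletion.eval_apply, AdicCompletion.map_val_apply,
    ← AdicCompletion.eval_apply, h]
  rfl

variable [IsParameterAlgebra K R]

theorem isAdicComplete_completedTensor :
    IsAdicComplete (maximalIdeal R) (CompletedTensor K R V) :=
  AdicCompletion.isAdicComplete (maximalIdeal_fg K R)

/-- Finite generation of `𝔪` makes the `𝔪`-adic filtration of the completion coincide with the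
kernels of its truncations. -/
theorem mem_pow_smul_top_iff (n : ℕ) (x : CompletedTensor K R V) :
    x ∈ (maximalIdeal R ^ n • ⊤ : Submodule R (CompletedTensor K R V)) ↔
      AdicCompletion.eval (maximalIdeal R) (R ⊗[K] V) n x = 0 := by
  rw [AdicCompletion.pow_smul_top_eq_ker_eval (maximalIdeal_fg K R), LinearMap.mem_ker]

theorem of_mem_pow_smul_top_iff (n : ℕ) (x : R ⊗[K] V) :
    AdicCompletion.of (maximalIdeal R) (R ⊗[K] V) x ∈
      (maximalIdeal R ^ n • ⊤ : Submodule R (CompletedTensor K R V)) ↔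
      x ∈ (maximalIdeal R ^ n • ⊤ : Submodule R (R ⊗[K] V)) := by
  rw [mem_pow_smul_top_iff, AdicCompletion.eval_of, Submodule.mkQ_apply,
    Submodule.Quotient.mk_eq_zero]

theorem exists_sub_of_mem (n : ℕ) (x : CompletedTensor K R V) :
    ∃ y, x - AdicCompletion.of (maximalIdeal R) (R ⊗[K] V) y ∈
      (maximalIdeal R ^ n • ⊤ : Submodule R (CompletedTensor K R V)) := by
  obtain ⟨y, hy⟩ := Submodule.mkQ_surjective _
    (AdicCompletion.eval (maximalIdeal R) (R ⊗[K] V) n x)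
  refine ⟨y, ?_⟩
  rw [mem_pow_smul_top_iff, map_sub, AdicCompletion.eval_of, hy, sub_self]

theorem eq_of_forall_sub_mem {x y : CompletedTensor K R V}
    (h : ∀ n, x - y ∈ (maximalIdeal R ^ n • ⊤ : Submodule R (CompletedTensor K R V))) :
    x = y := by
  refine AdicCompletion.ext fun n => ?_
  have := (mem_pow_smul_top_iff n _).1 (h n)
  rw [map_sub, sub_eq_zero] at this
  exact this

/-- The slice by a functional on `R` that vanishes on a power of the maximal ideal extends to the
completed tensor product. -/
theorem exists_completed_slice (n : ℕ) (l : R →ₗ[K] K) (hl : ∀ r ∈ maximalIdeal R ^ n, l r = 0) :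
    ∃ L : CompletedTensor K R V →+ V, (∀ r v, L (r • incl K R v) = l r • v) ∧
      (∀ k x, L (algebraMap K R k • x) = k • L x) ∧
      ∀ x ∈ (maximalIdeal R ^ n • ⊤ : Submodule R (CompletedTensor K R V)), L x = 0 := by
  let N := (maximalIdeal R ^ n • ⊤ : Submodule R (R ⊗[K] V))
  let f : (R ⊗[K] V) ⧸ N.toAddSubgroup →+ V :=
    QuotientAddGroup.lift N.toAddSubgroup (slice V l).toAddMonoidHom
      (fun x hx => slice_eq_zero _ l hl x hx)
  refine ⟨f.comp (AdicCompletion.eval (maximalIdeal R) (R ⊗[K] V) n).toAddMonoidHom,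
    fun r v => ?_, fun k x => ?_, fun x hx => ?_⟩
  · rw [← of_tmul]
    exact slice_tmul l r v
  · change f (AdicCompletion.eval (maximalIdeal R) (R ⊗[K] V) n (algebraMap K R k • x)) =
      k • f (AdicCompletion.eval (maximalIdeal R) (R ⊗[K] V) n x)
    rw [map_smul]
    obtain ⟨y, hy⟩ := Submodule.mkQ_surjective _
      (AdicCompletion.eval (maximalIdeal R) (R ⊗[K] V) n x)
    rw [← hy, ← map_smul, algebraMap_smul]
    exact map_smul (slice V l) k y
  · have := (mem_pow_smul_top_iff n x).1 hx
    change f (AdicCompletion.eval (maximalIdeal R) (R ⊗[K] V) n x) = 0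
    rw [this]
    exact map_zero f

theorem aug_eq_zero_of_mem (x : CompletedTensor K R V)
    (hx : x ∈ (maximalIdeal R • ⊤ : Submodule R (CompletedTensor K R V))) :
    aug K R V x = 0 := by
  refine Submodule.smul_induction_on hx (fun r hr y _ => ?_) (fun x y hx hy => ?_)
  · rw [LinearMap.map_smulₛₗ, augmentation_eq_zero K R hr, zero_smul]
  · rw [map_add, hx, hy, add_zero]

/-- Since `R = K + 𝔪`, the tensor `r ⊗ v` is congruent to `1 ⊗ ε(r) v`, and modulo `𝔪` every element
comes from the uncompleted tensor product. -/
theorem sub_incl_aug_mem (x : CompletedTensor K R V) :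
    x - incl K R (aug K R V x) ∈ (maximalIdeal R • ⊤ : Submodule R (CompletedTensor K R V)) := by
  obtain ⟨y, hy⟩ := exists_sub_of_mem 1 x
  rw [pow_one] at hy
  have h1 (y : R ⊗[K] V) : AdicCompletion.of (maximalIdeal R) (R ⊗[K] V) y -
      incl K R (augTensor K R V y) ∈
        (maximalIdeal R • ⊤ : Submodule R (CompletedTensor K R V)) := by
    induction y with
    | zero => simp [incl]
    | tmul r v =>
      have : augTensor K R V (r ⊗ₜ v) = augmentation K R r • v := by simp [augTensor]
      rw [of_tmul, this, incl_smul, ← sub_smul]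
      exact Submodule.smul_mem_smul (sub_augmentation_mem K r) trivial
    | add x y hx hy =>
      rw [map_add, map_add, incl_add, add_sub_add_comm]
      exact Submodule.add_mem _ hx hy
  have h2 := aug_eq_zero_of_mem _ hy
  rw [map_sub, sub_eq_zero] at h2
  rw [h2, ← sub_add_sub_cancel x (AdicCompletion.of (maximalIdeal R) (R ⊗[K] V) y)]
  exact Submodule.add_mem _ hy (h1 y)

end Completion

/-! ### Linear maps and adic filtrations -/

section Filtration

theorem map_mem_smul_top {R M N : Type*} [CommRing R] [AddCommGroup M] [Module R M]
    [AddCommGroup N] [Module R N] (I : Ideal R) (f : M →ₗ[R] N) {x : M}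
    (hx : x ∈ (I • ⊤ : Submodule R M)) : f x ∈ (I • ⊤ : Submodule R N) := by
  have h := Submodule.mem_map_of_mem (f := f) hx
  rw [Submodule.map_smul''] at h
  exact (smul_mono_right I (le_top : Submodule.map f ⊤ ≤ ⊤) :) h

theorem map_mem_pow_succ_smul_top {R M N : Type*} [CommRing R] [AddCommGroup M] [Module R M]
    [AddCommGroup N] [Module R N] (I : Ideal R) (n : ℕ) (f : M →ₗ[R] N)
    (hf : ∀ x, f x ∈ (I ^ n • ⊤ : Submodule R N)) {x : M}
    (hx : x ∈ (I • ⊤ : Submodule R M)) : f x ∈ (I ^ (n + 1) • ⊤ : Submodule R N) := by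
  refine Submodule.smul_induction_on hx (fun r hr y _ => ?_) (fun x y hx hy => ?_)
  · rw [map_smul, pow_succ', Submodule.mul_smul]
    exact Submodule.smul_mem_smul hr (hf y)
  · rw [map_add]; exact Submodule.add_mem _ hx hy

theorem smul_mem_pow_succ_smul_top {R M : Type*} [CommRing R] [AddCommGroup M] [Module R M]
    (I : Ideal R) (n : ℕ) {r : R} (hr : r ∈ I ^ n) {x : M} (hx : x ∈ (I • ⊤ : Submodule R M)) :
    r • x ∈ (I ^ (n + 1) • ⊤ : Submodule R M) := by
  rw [pow_succ, Submodule.mul_smul]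
  exact Submodule.smul_mem_smul hr hx

theorem pow_smul_top_le_smul_top {R M : Type*} [CommRing R] [AddCommGroup M] [Module R M]
    (I : Ideal R) {m n : ℕ} (h : m ≤ n) :
    (I ^ n • ⊤ : Submodule R M) ≤ I ^ m • ⊤ :=
  Submodule.smul_mono_left (Ideal.pow_le_pow_right h)

end Filtration

/-! ### The deformation step -/

section Deformation

variable {K R C : Type*} [Field K] [CommRing R] [Algebra K R] [IsLocalRing R]
  [CommRing C] [Algebra K C]

variable (μ : CompletedTensor K R C →ₗ[R] CompletedTensor K R C →ₗ[R] CompletedTensor K R C)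

/-- A product on `A` is differential modulo `𝔪 ^ n`. -/
def IsDifferentialMod (n : ℕ) : Prop :=
  ∃ (J : Type) (_ : Fintype J) (s : J → R) (φ : J → NormalizedBiDiffOp K C),
    (∀ j, s j ∈ maximalIdeal R) ∧
    ∀ a b : C, μ (incl K R a) (incl K R b) - incl K R (a * b) -
      ∑ j, s j • incl K R ((φ j).1 (a ⊗ₜ b)) ∈
        (maximalIdeal R ^ n • ⊤ : Submodule R (CompletedTensor K R C))

variable {μ}

/-- By `R`-bilinearity the expansion `h` can be inserted into itself modulo `𝔪 ^ k`, which `L`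
annihilates. Together with `slice_product_right` this turns associativity into identities between
cochains. -/
theorem slice_product_left
    {k : ℕ} {J : Type*} [Fintype J] {s : J → R} {φ : J → (C ⊗[K] C →ₗ[K] C)}
    (h : ∀ a b : C, μ (incl K R a) (incl K R b) - ∑ j, s j • incl K R (φ j (a ⊗ₜ b)) ∈
      (maximalIdeal R ^ k • ⊤ : Submodule R (CompletedTensor K R C)))
    {l : R →ₗ[K] K} {L : CompletedTensor K R C →+ C}
    (hL : ∀ r v, L (r • incl K R v) = l r • v)
    (hL0 : ∀ x ∈ (maximalIdeal R ^ k • ⊤ : Submodule R (CompletedTensor K R C)), L x = 0)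
    (a b c : C) :
    L (μ (μ (incl K R a) (incl K R b)) (incl K R c)) =
      ∑ i, ∑ j, l (s i * s j) • φ j (φ i (a ⊗ₜ b) ⊗ₜ c) := by
  have h1 : μ (μ (incl K R a) (incl K R b)) (incl K R c) -
      ∑ i, ∑ j, (s i * s j) • incl K R (φ j (φ i (a ⊗ₜ b) ⊗ₜ c)) ∈
        (maximalIdeal R ^ k • ⊤ : Submodule R (CompletedTensor K R C)) := by
    have h2 := map_mem_smul_top _ (μ.flip (incl K R c)) (h a b)
    have h3 := Submodule.sum_mem _ fun i (_ : i ∈ Finset.univ) =>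
      Submodule.smul_mem _ (s i) (h (φ i (a ⊗ₜ b)) c)
    convert Submodule.add_mem _ h2 h3 using 1
    simp only [map_sub, map_sum, LinearMap.map_smul, LinearMap.flip_apply, smul_sub,
      LinearMap.smul_apply,
      Finset.sum_sub_distrib, Finset.smul_sum, mul_smul]
    abel
  have h4 := hL0 _ h1
  rw [map_sub, sub_eq_zero] at h4
  rw [h4]
  simp only [map_sum, hL]

theorem slice_product_right
    {k : ℕ} {J : Type*} [Fintype J] {s : J → R} {φ : J → (C ⊗[K] C →ₗ[K] C)}
    (h : ∀ a b : C, μ (incl K R a) (incl K R b) - ∑ j, s j • incl K R (φ j (a ⊗ₜ b)) ∈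
      (maximalIdeal R ^ k • ⊤ : Submodule R (CompletedTensor K R C)))
    {l : R →ₗ[K] K} {L : CompletedTensor K R C →+ C}
    (hL : ∀ r v, L (r • incl K R v) = l r • v)
    (hL0 : ∀ x ∈ (maximalIdeal R ^ k • ⊤ : Submodule R (CompletedTensor K R C)), L x = 0)
    (a b c : C) :
    L (μ (incl K R a) (μ (incl K R b) (incl K R c))) =
      ∑ i, ∑ j, l (s i * s j) • φ j (a ⊗ₜ φ i (b ⊗ₜ c)) := by
  have h1 : μ (incl K R a) (μ (incl K R b) (incl K R c)) -
      ∑ i, ∑ j, (s i * s j) • incl K R (φ j (a ⊗ₜ φ i (b ⊗ₜ c))) ∈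
        (maximalIdeal R ^ k • ⊤ : Submodule R (CompletedTensor K R C)) := by
    have h2 := map_mem_smul_top _ (μ (incl K R a)) (h b c)
    have h3 := Submodule.sum_mem _ fun i (_ : i ∈ Finset.univ) =>
      Submodule.smul_mem _ (s i) (h a (φ i (b ⊗ₜ c)))
    convert Submodule.add_mem _ h2 h3 using 1
    simp only [map_sub, map_sum, LinearMap.map_smul, smul_sub,
      Finset.sum_sub_distrib, Finset.smul_sum, mul_smul]
    abel
  have h4 := hL0 _ h1
  rw [map_sub, sub_eq_zero] at h4
  rw [h4]
  simp only [map_sum, hL]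

variable [IsParameterAlgebra K R]

/-- An element of `𝔪 ^ n A` is determined modulo `𝔪 ^ (n + 1) A` by its slices. -/
theorem sub_sum_slice_mem {V : Type*} [AddCommGroup V] [Module K V] (n : ℕ) {ι : Type*} [Fintype ι]
    (t : ι → R) (l : ι → (R →ₗ[K] K))
    (ht : ∀ r ∈ maximalIdeal R ^ n, r - ∑ i, algebraMap K R (l i r) * t i ∈
        maximalIdeal R ^ (n + 1))
    (L : ι → (CompletedTensor K R V →+ V)) (hL : ∀ i r v, L i (r • incl K R v) = l i r • v)
    (hL0 : ∀ i, ∀ x ∈ (maximalIdeal R ^ (n + 1) • ⊤ : Submodule R (CompletedTensor K R V)),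
      L i x = 0)
    (x : CompletedTensor K R V)
    (hx : x ∈ (maximalIdeal R ^ n • ⊤ : Submodule R (CompletedTensor K R V))) :
    x - ∑ i, t i • incl K R (L i x) ∈
      (maximalIdeal R ^ (n + 1) • ⊤ : Submodule R (CompletedTensor K R V)) := by
  refine Submodule.smul_induction_on hx (fun r hr a _ => ?_) (fun x y hx hy => ?_)
  · set v := aug K R V a
    have h1 : r • (a - incl K R v) ∈
        (maximalIdeal R ^ (n + 1) • ⊤ : Submodule R (CompletedTensor K R V)) :=
      smul_mem_pow_succ_smul_top _ n hr (sub_incl_aug_mem a)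
    have h2 (i) : L i (r • a) = l i r • v := by
      have := hL0 i _ h1
      rwa [smul_sub, map_sub, hL, sub_eq_zero] at this
    have h3 : (r - ∑ i, algebraMap K R (l i r) * t i) • incl K R v ∈
        (maximalIdeal R ^ (n + 1) • ⊤ : Submodule R (CompletedTensor K R V)) :=
      Submodule.smul_mem_smul (ht r hr) trivial
    convert Submodule.add_mem _ h1 h3 using 1
    simp only [h2, incl_smul, sub_smul, smul_sub, Finset.sum_smul, mul_smul]
    simp only [smul_comm (t _)]
    abel
  · convert Submodule.add_mem _ hx hy using 1
    simp only [map_add, incl_add, smul_add, Finset.sum_add_distrib]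
    abel

/-- The slices of the remainder of a star product that is differential modulo `𝔪 ^ n` have
differential Hochschild coboundary. -/
theorem isUniformlyDiff_coboundaryTwo_slice (hμ : IsStarProduct K R C μ) {n : ℕ} (hn : 1 ≤ n)
    {J : Type*} [Fintype J] {s : J → R} {φ : J → NormalizedBiDiffOp K C}
    (hs : ∀ j, s j ∈ maximalIdeal R) {ι : Type*} [Fintype ι] [DecidableEq ι] {t : ι → R}
    {γ : ι → (C ⊗[K] C →ₗ[K] C)} (ht : ∀ i, t i ∈ maximalIdeal R ^ n)
    (h : ∀ a b : C, μ (incl K R a) (incl K R b) - incl K R (a * b) -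
      ∑ j, s j • incl K R ((φ j).1 (a ⊗ₜ b)) - ∑ i, t i • incl K R (γ i (a ⊗ₜ b)) ∈
        (maximalIdeal R ^ (n + 1) • ⊤ : Submodule R (CompletedTensor K R C)))
    (p : ι) {l : R →ₗ[K] K} (hl : ∀ r ∈ maximalIdeal R ^ (n + 1), l r = 0)
    (hlt : ∀ i, l (t i) = if p = i then 1 else 0) :
    IsUniformlyDiff (coboundaryTwo (γ p)) := by
  obtain ⟨L, hL, -, hL0⟩ := exists_completed_slice (V := C) (n + 1) l hl
  -- The index `none` carries the undeformed product with coefficient `1`, so that the whole star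
  -- product is one sum.
  let S : Option (J ⊕ ι) → R := fun o => o.elim 1 (Sum.elim s t)
  let Φ : Option (J ⊕ ι) → (C ⊗[K] C →ₗ[K] C) :=
    fun o => o.elim (Algebra.TensorProduct.lmul' K (S := C)).toLinearMap
      (Sum.elim (fun j => (φ j).1) γ)
  have h' : ∀ a b : C, μ (incl K R a) (incl K R b) - ∑ j, S j • incl K R (Φ j (a ⊗ₜ b)) ∈
      (maximalIdeal R ^ (n + 1) • ⊤ : Submodule R (CompletedTensor K R C)) := by
    intro a b
    convert h a b using 1
    simp only [S, Φ, Fintype.sum_option, Fintype.sum_sum_type, Option.elim_none, Option.elim_some,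
      Sum.elim_inl, Sum.elim_inr, one_smul, AlgHom.toLinearMap_apply,
      Algebra.TensorProduct.lmul'_apply_tmul]
    abel
  -- The `l`-coefficient of associativity. Products involving some `t` and another `s` or `t` lie in
  -- `𝔪 ^ (n + 1)`, so the `γ i` meet only the undeformed product, and `l` keeps just the coboundary
  -- of `γ p`.
  have e : coboundaryTwo (γ p) = fun a =>
      (∑ i, ∑ j, l (s i * s j) • ((φ j).1 ∘ₗ (TensorProduct.curry (φ i).1 a).rTensor C -
        TensorProduct.curry (φ j).1 a ∘ₗ (φ i).1)) -
      ∑ j, l (s j) • coboundaryTwo (φ j).1 a := by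
    funext a
    ext b c
    have h1 := slice_product_left h' hL hL0 a b c
    rw [hμ.assoc, slice_product_right h' hL hL0 a b c] at h1
    have l1 (i : J) (j : ι) : l (s i * t j) = 0 := hl _ (by
      rw [pow_succ']; exact Ideal.mul_mem_mul (hs i) (ht j))
    have l2 (i : J) (j : ι) : l (t j * s i) = 0 := by rw [mul_comm, l1]
    have l3 (i j : ι) : l (t i * t j) = 0 := hl _ (by
      rw [pow_succ']
      exact Ideal.mul_mem_mul (Ideal.pow_le_self (by lia) (ht i)) (ht j))
    simp only [S, Φ, Fintype.sum_option, Fintype.sum_sum_type, Option.elim_none, Option.elim_some,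
      Sum.elim_inl, Sum.elim_inr, AlgHom.toLinearMap_apply, one_mul, mul_one, l1, l2, l3, hlt,
      Algebra.TensorProduct.lmul'_apply_tmul, zero_smul, Finset.sum_const_zero, add_zero,
      ite_smul, one_smul, Finset.sum_ite_eq, Finset.mem_univ, if_true,
      Finset.sum_add_distrib] at h1
    simp only [TensorProduct.AlgebraTensorModule.curry_apply, TensorProduct.curry_apply,
      LinearMap.restrictScalars_apply,
      coboundaryTwo_tmul, LinearMap.sub_apply, LinearMap.sum_apply,
      LinearMap.smul_apply, LinearMap.comp_apply, LinearMap.rTensor_tmul, smul_sub, smul_add,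
      Finset.sum_sub_distrib, Finset.sum_add_distrib]
    rw [mul_assoc a b c] at h1
    linear_combination h1
  rw [e]
  refine IsUniformlyDiff.sub (IsUniformlyDiff.sum _ fun i _ => IsUniformlyDiff.sum _ fun j _ =>
    IsUniformlyDiff.smul _ (IsUniformlyDiff.sub ?_ ?_))
    (IsUniformlyDiff.sum _ fun j _ => IsUniformlyDiff.smul _ ?_)
  · exact isUniformlyDiff_comp_left (φ i).2.2 (φ j).2.2
  · exact isUniformlyDiff_comp_right (φ i).2.2 (φ j).2.2
  · exact isUniformlyDiff_coboundaryTwo (φ j).2.2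

/-- The deformation step: a star product that is differential modulo `𝔪 ^ n` is differential modulo
`𝔪 ^ (n + 1)` after a gauge transformation that is the identity modulo `𝔪 ^ n`. -/
theorem exists_gauge_step [Algebra.FormallySmooth K C] [Algebra.FiniteType K C]
    (hμ : IsStarProduct K R C μ) {n : ℕ} (hn : 1 ≤ n) (h : IsDifferentialMod μ n) :
    ∃ H : CompletedTensor K R C →ₗ[R] CompletedTensor K R C,
      (∀ x, H x ∈ (maximalIdeal R ^ n • ⊤ : Submodule R (CompletedTensor K R C))) ∧
      H (incl K R 1) = 0 ∧
      ∀ μ' : CompletedTensor K R C →ₗ[R] CompletedTensor K R C →ₗ[R] CompletedTensor K R C,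
        IsStarProduct K R C μ' → (∀ a b, μ' (a + H a) (b + H b) = μ a b + H (μ a b)) →
        IsDifferentialMod μ' (n + 1) := by
  obtain ⟨J, _, s, φ, hs, h⟩ := h
  obtain ⟨d, t, l, ht, hl, hlt, hd⟩ := exists_dual_basis_pow K R n
  choose L hL hLK hL0 using fun i => exists_completed_slice (V := C) (n + 1) (l i) (hl i)
  -- The slice of the remainder, expanded. The values `l i 1` and `l i (s j)` need not vanish, since
  -- the dual-basis conditions do not constrain them.
  let γ (i : Fin d) : C ⊗[K] C →ₗ[K] C :=
    TensorProduct.lift (LinearMap.mk₂ K (fun a b => L i (μ (incl K R a) (incl K R b)))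
      (fun a a' b => by rw [incl_add, map_add, LinearMap.add_apply, map_add])
      (fun k a b => by rw [incl_smul, map_smul, LinearMap.smul_apply, hLK])
      (fun a b b' => by rw [incl_add, map_add, map_add])
      (fun k a b => by rw [incl_smul, map_smul, hLK])) -
    l i 1 • (Algebra.TensorProduct.lmul' K (S := C)).toLinearMap -
    ∑ j, l i (s j) • (φ j).1
  have hγ (i : Fin d) (a b : C) : γ i (a ⊗ₜ b) = L i (μ (incl K R a) (incl K R b) -
      incl K R (a * b) - ∑ j, s j • incl K R ((φ j).1 (a ⊗ₜ b))) := by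
    have e : L i (incl K R (a * b)) = l i 1 • (a * b) := by rw [← hL, one_smul]
    rw [map_sub, map_sub, e, map_sum]
    simp only [hL]
    simp [γ, LinearMap.sum_apply]
  have h2 (a b : C) := sub_sum_slice_mem n t l hd L hL hL0 _ (h a b)
  simp only [← hγ] at h2
  have hγ1 (i : Fin d) (c : C) : γ i (1 ⊗ₜ c) = 0 ∧ γ i (c ⊗ₜ 1) = 0 := by
    constructor
    · rw [hγ, hμ.one_left, one_mul, sub_self, zero_sub]
      simp [((φ _).2.1 c).1, incl]
    · rw [hγ, hμ.one_right, mul_one, sub_self, zero_sub]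
      simp [((φ _).2.1 c).2, incl]
  choose η hη1 hη using fun i => exists_sub_coboundaryOne_mem (γ i) (hγ1 i)
    (isUniformlyDiff_coboundaryTwo_slice hμ hn hs ht h2 i (hl i) (hlt i))
  let H : CompletedTensor K R C →ₗ[R] CompletedTensor K R C :=
    ∑ i, t i • completedLinearMap R (η i)
  have hHt (x) : H x = ∑ i, t i • completedLinearMap R (η i) x := by
    simp [H, LinearMap.sum_apply]
  have hH (c : C) : H (incl K R c) = ∑ i, t i • incl K R (η i c) := by
    simp only [hHt, completedLinearMap_incl]
  have hHn (x) : H x ∈ (maximalIdeal R ^ n • ⊤ : Submodule R (CompletedTensor K R C)) := by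
    rw [hHt]
    exact Submodule.sum_mem _ fun i _ => Submodule.smul_mem_smul (ht i) trivial
  have hHm (x) : H x ∈ (maximalIdeal R • ⊤ : Submodule R (CompletedTensor K R C)) := by
    have := pow_smul_top_le_smul_top _ hn (hHn x)
    rwa [pow_one] at this
  refine ⟨H, hHn, ?_, fun μ' hμ' hconj => ⟨J ⊕ Fin d, inferInstance, Sum.elim s t,
    Sum.elim φ (fun i => ⟨γ i - coboundaryOne (η i), hη i⟩), ?_, fun a b => ?_⟩⟩
  · rw [hH]
    simp [hη1, incl]
  · rintro (j | i)
    · exact hs j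
    · exact Ideal.pow_le_self (by lia) (ht i)
  -- As `H` takes values in `𝔪 ^ n A`, modulo `𝔪 ^ (n + 1)` every product next to it may be replaced
  -- by the product of `C`, and the term quadratic in `H` disappears because `n ≥ 1`. Hence
  -- conjugation replaces `γ i` by `γ i - coboundaryOne (η i)`.
  · have c1 : H (μ (incl K R a) (incl K R b)) - ∑ i, t i • incl K R (η i (a * b)) ∈
        (maximalIdeal R ^ (n + 1) • ⊤ : Submodule R (CompletedTensor K R C)) := by
      rw [← hH, ← map_sub]
      exact map_mem_pow_succ_smul_top _ n H hHn (hμ.mod_max a b)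
    have c2 : μ' (H (incl K R a)) (incl K R b) - ∑ i, t i • incl K R (η i a * b) ∈
        (maximalIdeal R ^ (n + 1) • ⊤ : Submodule R (CompletedTensor K R C)) := by
      have := Submodule.sum_mem _ fun i (_ : i ∈ Finset.univ) =>
        smul_mem_pow_succ_smul_top _ n (ht i) (hμ'.mod_max (η i a) b)
      convert this using 1
      simp only [hH, map_sum, LinearMap.map_smul, LinearMap.sum_apply, LinearMap.smul_apply,
        smul_sub, Finset.sum_sub_distrib]
    have c3 : μ' (incl K R a) (H (incl K R b)) - ∑ i, t i • incl K R (a * η i b) ∈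
        (maximalIdeal R ^ (n + 1) • ⊤ : Submodule R (CompletedTensor K R C)) := by
      have := Submodule.sum_mem _ fun i (_ : i ∈ Finset.univ) =>
        smul_mem_pow_succ_smul_top _ n (ht i) (hμ'.mod_max a (η i b))
      convert this using 1
      simp only [hH, map_sum, LinearMap.map_smul, smul_sub, Finset.sum_sub_distrib]
    have c4 : μ' (H (incl K R a)) (H (incl K R b)) ∈
        (maximalIdeal R ^ (n + 1) • ⊤ : Submodule R (CompletedTensor K R C)) := by
      exact map_mem_pow_succ_smul_top _ n (μ'.flip (H (incl K R b)))
        (fun x => map_mem_smul_top _ (μ' x) (hHn _)) (hHm _)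
    have c5 := hconj (incl K R a) (incl K R b)
    simp only [map_add, LinearMap.add_apply] at c5
    have c6 := Submodule.sub_mem _ (Submodule.sub_mem _ (Submodule.sub_mem _
      (Submodule.add_mem _ (h2 a b) c1) c2) c3) c4
    convert c6 using 1
    have c7 (x y : C) : incl K R (x - y) = incl K R x - incl K R y := by
      simp [incl, TensorProduct.tmul_sub]
    simp only [Fintype.sum_sum_type, Sum.elim_inl, Sum.elim_inr, LinearMap.sub_apply,
      coboundaryOne_tmul, c7, incl_add, smul_sub, smul_add, Finset.sum_add_distrib,
      Finset.sum_sub_distrib]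
    rw [← sub_eq_zero] at c5 ⊢
    refine Eq.trans ?_ c5
    abel

end Deformation

/-! ### Limits and automorphisms of complete modules -/

section Limit

variable {R M : Type*} [CommRing R] [AddCommGroup M] [Module R M] (I : Ideal R)

/-- Limits of sequences of endomorphisms of a complete module. -/
theorem exists_limit_linearMap [IsAdicComplete I M] (f : ℕ → M →ₗ[R] M)
    (hf : ∀ n x, f (n + 1) x - f n x ∈ (I ^ n • ⊤ : Submodule R M)) :
    ∃ F : M →ₗ[R] M, ∀ n x, F x - f n x ∈ (I ^ n • ⊤ : Submodule R M) := by
  have hmn {m n : ℕ} (h : m ≤ n) (x : M) : f n x - f m x ∈ (I ^ m • ⊤ : Submodule R M) := by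
    induction n, h using Nat.le_induction with
    | base => simp
    | succ n h ih =>
      rw [← sub_add_sub_cancel (f (n + 1) x) (f n x)]
      exact Submodule.add_mem _ (pow_smul_top_le_smul_top I h (hf n x)) ih
  have hcomp {m n : ℕ} (h : m ≤ n) : Submodule.factorPow I M h ∘ₗ
      (Submodule.mkQ (I ^ n • ⊤ : Submodule R M) ∘ₗ f n) =
        Submodule.mkQ (I ^ m • ⊤ : Submodule R M) ∘ₗ f m := by
    ext x
    exact (Submodule.Quotient.eq _).2 (hmn h x)
  refine ⟨IsAdicComplete.lift I _ hcomp, fun n x => ?_⟩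
  exact (Submodule.Quotient.eq _).1 (IsAdicComplete.mk_lift I hcomp n x)

theorem eq_of_forall_sub_mem_pow [IsHausdorff I M] {x y : M}
    (h : ∀ n, x - y ∈ (I ^ n • ⊤ : Submodule R M)) : x = y := by
  rw [← sub_eq_zero]
  exact IsHausdorff.haus ‹_› _ fun n => SModEq.zero.2 (h n)

theorem pow_apply_mem (h : Module.End R M) (hh : ∀ x, h x ∈ (I • ⊤ : Submodule R M)) (n : ℕ)
    (x : M) : (h ^ n) x ∈ (I ^ n • ⊤ : Submodule R M) := by
  induction n generalizing x with
  | zero => simp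
  | succ n ih =>
    have e : (h ^ (n + 1)) x = (h ^ n) (h x) := by rw [pow_succ]; rfl
    rw [e]
    exact map_mem_pow_succ_smul_top I n (h ^ n) ih (hh x)

/-- An endomorphism of a complete module that is the identity modulo the ideal is invertible. -/
theorem exists_linearEquiv_add [IsAdicComplete I M] (h : M →ₗ[R] M)
    (hh : ∀ x, h x ∈ (I • ⊤ : Submodule R M)) : ∃ e : M ≃ₗ[R] M, ∀ x, e x = x + h x := by
  let u : Module.End R M := -h
  have hu (n : ℕ) (x : M) := pow_apply_mem I u (fun x => neg_mem (hh x)) n x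
  have hu1 (x : M) : (1 - u : Module.End R M) x = x + h x := by simp [u]
  -- The geometric series inverts `1 - u`, where `u = -h`.
  obtain ⟨F, hF⟩ := exists_limit_linearMap I (fun n => ∑ i ∈ Finset.range n, u ^ i) (by
    intro n x
    rw [Finset.sum_range_succ, LinearMap.add_apply, add_sub_cancel_left]
    exact hu n x)
  refine ⟨LinearEquiv.ofLinearMap (1 - u) F ?_ ?_, hu1⟩
  · ext x
    refine eq_of_forall_sub_mem_pow I fun n => ?_
    have h1 := map_mem_smul_top _ (1 - u) (hF n x)
    have h2 := LinearMap.congr_fun (mul_neg_geom_sum u n) x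
    rw [Module.End.mul_apply, LinearMap.sub_apply (1 : Module.End R M) (u ^ n)] at h2
    rw [map_sub, h2] at h1
    convert Submodule.sub_mem _ h1 (hu n x) using 1
    simp
    abel
  · ext x
    refine eq_of_forall_sub_mem_pow I fun n => ?_
    have h1 := hF n ((1 - u) x)
    have h2 := LinearMap.congr_fun (geom_sum_mul_neg u n) x
    rw [Module.End.mul_apply, LinearMap.sub_apply (1 : Module.End R M) (u ^ n)] at h2
    rw [h2] at h1
    convert Submodule.sub_mem _ h1 (hu n x) using 1
    simp
    abel

theorem bilinear_sub_mem (μ : M →ₗ[R] M →ₗ[R] M) {x x' y y' : M}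
    (hx : x - x' ∈ (I • ⊤ : Submodule R M)) (hy : y - y' ∈ (I • ⊤ : Submodule R M)) :
    μ x y - μ x' y' ∈ (I • ⊤ : Submodule R M) := by
  have h1 := map_mem_smul_top I (μ.flip y) hx
  have h2 := map_mem_smul_top I (μ x') hy
  convert Submodule.add_mem _ h1 h2 using 1
  simp

/-- The transport of a product by a linear automorphism. -/
def conjProduct (g : M ≃ₗ[R] M) (μ : M →ₗ[R] M →ₗ[R] M) : M →ₗ[R] M →ₗ[R] M :=
  (μ.compl₁₂ g.symm.toLinearMap g.symm.toLinearMap).compr₂ g.toLinearMap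

theorem conjProduct_apply (g : M ≃ₗ[R] M) (μ : M →ₗ[R] M →ₗ[R] M) (a b : M) :
    conjProduct g μ a b = g (μ (g.symm a) (g.symm b)) := rfl

theorem conjProduct_apply_apply (g : M ≃ₗ[R] M) (μ : M →ₗ[R] M →ₗ[R] M) (a b : M) :
    conjProduct g μ (g a) (g b) = g (μ a b) := by
  simp [conjProduct_apply]

/-- Congruent automorphisms have congruent inverses: `g⁻¹ x - g'⁻¹ x = -g'⁻¹ ((g - g') (g⁻¹ x))`. -/
theorem conjProduct_sub_mem (g g' : M ≃ₗ[R] M) (μ : M →ₗ[R] M →ₗ[R] M)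
    (h : ∀ x, g x - g' x ∈ (I • ⊤ : Submodule R M)) (a b : M) :
    conjProduct g μ a b - conjProduct g' μ a b ∈ (I • ⊤ : Submodule R M) := by
  have hs (x : M) : g.symm x - g'.symm x ∈ (I • ⊤ : Submodule R M) := by
    have := map_mem_smul_top I g'.symm.toLinearMap (h (g.symm x))
    rw [← neg_mem_iff]
    simpa using this
  have h1 := map_mem_smul_top I g'.toLinearMap (bilinear_sub_mem I μ (hs a) (hs b))
  convert Submodule.add_mem _ (h (μ (g.symm a) (g.symm b))) h1 using 1
  simp [conjProduct_apply]

end Limit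

/-! ### Construction of the gauge transformation -/

section Gauge

variable {K R C : Type*} [Field K] [CommRing R] [Algebra K R] [IsLocalRing R]
  [CommRing C] [Algebra K C]
  {μ : CompletedTensor K R C →ₗ[R] CompletedTensor K R C →ₗ[R] CompletedTensor K R C}

theorem IsStarProduct.conjProduct (hμ : IsStarProduct K R C μ)
    (g : CompletedTensor K R C ≃ₗ[R] CompletedTensor K R C)
    (hg : ∀ x, g x - x ∈ (maximalIdeal R • ⊤ : Submodule R (CompletedTensor K R C)))
    (hg1 : g (incl K R 1) = incl K R 1) : IsStarProduct K R C (conjProduct g μ) := by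
  have hg1' : g.symm (incl K R 1) = incl K R 1 := by rw [LinearEquiv.symm_apply_eq, hg1]
  refine ⟨fun a b c => ?_, fun a => ?_, fun a => ?_, fun a b => ?_⟩
  · simp [conjProduct_apply, hμ.assoc]
  · simp [conjProduct_apply, hg1', hμ.one_left]
  · simp [conjProduct_apply, hg1', hμ.one_right]
  · have h1 := conjProduct_sub_mem _ g (LinearEquiv.refl R _) μ hg (incl K R a) (incl K R b)
    convert Submodule.add_mem _ h1 (hμ.mod_max a b) using 1
    simp [conjProduct_apply]

theorem IsDifferentialMod.of_sub_mem
    {μ' : CompletedTensor K R C →ₗ[R] CompletedTensor K R C →ₗ[R] CompletedTensor K R C}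
    {m n : ℕ} (h : IsDifferentialMod μ n) (hmn : m ≤ n)
    (hμ : ∀ a b, μ' a b - μ a b ∈ (maximalIdeal R ^ m • ⊤ : Submodule R (CompletedTensor K R C))) :
    IsDifferentialMod μ' m := by
  obtain ⟨J, hJ, s, φ, hs, h⟩ := h
  refine ⟨J, hJ, s, φ, hs, fun a b => ?_⟩
  convert Submodule.add_mem _ (hμ (incl K R a) (incl K R b))
    (pow_smul_top_le_smul_top _ hmn (h a b)) using 1
  abel

theorem isDifferentialMod_one (hμ : IsStarProduct K R C μ) : IsDifferentialMod μ 1 := by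
  refine ⟨Empty, inferInstance, fun j => j.elim, fun j => j.elim, fun j => j.elim, fun a b => ?_⟩
  rw [pow_one]
  simpa using hμ.mod_max a b

variable [IsParameterAlgebra K R]

/-- Compatible approximations by elements of `R ⊗ V` are realized by an element of the completed
tensor product if the maps used to compare them are jointly injective on `V`. -/
theorem exists_completedMap_eq {V W ι : Type*} [AddCommGroup V] [Module K V] [AddCommGroup W]
    [Module K W] (f : ι → (V →ₗ[K] W)) (hf : ∀ v, (∀ i, f i v = 0) → v = 0)
    (x : ι → CompletedTensor K R W)
    (h : ∀ n, ∃ τ : R ⊗[K] V, τ ∈ (maximalIdeal R • ⊤ : Submodule R (R ⊗[K] V)) ∧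
      ∀ i, x i - AdicCompletion.of (maximalIdeal R) (R ⊗[K] W) ((f i).baseChange R τ) ∈
        (maximalIdeal R ^ n • ⊤ : Submodule R (CompletedTensor K R W))) :
    ∃ β : CompletedTensor K R V, aug K R V β = 0 ∧ ∀ i, x i = completedMap K R (f i) β := by
  choose τ hτ hτx using h
  -- The `τ n` are chosen independently. Slicing by functionals reduces their compatibility to
  -- equalities in `V`, which the jointly injective maps `f i` can test.
  have hcauchy (n : ℕ) : τ n ≡ τ (n + 1)
      [SMOD (maximalIdeal R ^ n • ⊤ : Submodule R (R ⊗[K] V))] := by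
    rw [SModEq.sub_mem]
    refine mem_smul_top_of_slice_eq_zero _ _ fun l hl => hf _ fun i => ?_
    have h1 : (f i).baseChange R (τ n - τ (n + 1)) ∈
        (maximalIdeal R ^ n • ⊤ : Submodule R (R ⊗[K] W)) := by
      rw [← of_mem_pow_smul_top_iff]
      convert Submodule.sub_mem _ (pow_smul_top_le_smul_top _ (Nat.le_succ n) (hτx (n + 1) i))
        (hτx n i) using 1
      rw [map_sub, map_sub]
      abel
    have h2 := slice_eq_zero _ l hl _ h1
    rwa [slice_baseChange] at h2
  let β : CompletedTensor K R V :=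
    AdicCompletion.mk _ _ (AdicCompletion.AdicCauchySequence.mk _ _ τ hcauchy)
  have hβ (n : ℕ) : AdicCompletion.eval (maximalIdeal R) _ n β = Submodule.mkQ _ (τ n) := rfl
  refine ⟨β, ?_, fun i => ?_⟩
  · refine aug_eq_zero_of_mem β ?_
    have h1 : β - AdicCompletion.of _ _ (τ 1) ∈ (maximalIdeal R ^ 1 • ⊤ :
        Submodule R (CompletedTensor K R V)) := by
      rw [mem_pow_smul_top_iff, map_sub, hβ, AdicCompletion.eval_of, sub_self]
    rw [pow_one] at h1
    have h2 := map_mem_smul_top _ (AdicCompletion.of (maximalIdeal R) (R ⊗[K] V)) (hτ 1)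
    rw [← sub_add_cancel β (AdicCompletion.of _ _ (τ 1))]
    exact Submodule.add_mem _ h1 h2
  · refine eq_of_forall_sub_mem fun n => ?_
    have h1 : completedMap K R (f i) β - AdicCompletion.of (maximalIdeal R) (R ⊗[K] W)
        ((f i).baseChange R (τ n)) ∈
        (maximalIdeal R ^ n • ⊤ : Submodule R (CompletedTensor K R W)) := by
      rw [mem_pow_smul_top_iff, map_sub, completedMap_eval _ n β (τ n) (hβ n),
        AdicCompletion.eval_of, sub_self]
    convert Submodule.sub_mem _ (hτx n i) h1 using 1
    abel

/-- A star product that is differential modulo all powers of the maximal ideal is differential. -/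
theorem isDifferentialStarProduct_of_forall_mod (hμ : IsStarProduct K R C μ)
    (h : ∀ n, IsDifferentialMod μ n) : IsDifferentialStarProduct K R C μ := by
  have hτ (n : ℕ) : ∃ τ : R ⊗[K] NormalizedBiDiffOp K C,
      τ ∈ (maximalIdeal R • ⊤ : Submodule R (R ⊗[K] NormalizedBiDiffOp K C)) ∧
      ∀ ab : C × C, μ (incl K R ab.1) (incl K R ab.2) - incl K R (ab.1 * ab.2) -
        AdicCompletion.of (maximalIdeal R) (R ⊗[K] C)
          ((evalBiDiff K ab.1 ab.2).baseChange R τ) ∈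
        (maximalIdeal R ^ n • ⊤ : Submodule R (CompletedTensor K R C)) := by
    obtain ⟨J, _, s, φ, hs, h⟩ := h n
    refine ⟨∑ j, s j ⊗ₜ φ j, Submodule.sum_mem _ fun j _ => tmul_mem_smul_top _ (hs j) (φ j),
      fun ab => ?_⟩
    have e : AdicCompletion.of (maximalIdeal R) (R ⊗[K] C)
        ((evalBiDiff K ab.1 ab.2).baseChange R (∑ j, s j ⊗ₜ φ j)) =
        ∑ j, s j • incl K R ((φ j).1 (ab.1 ⊗ₜ ab.2)) := by
      simp only [map_sum, LinearMap.baseChange_tmul, of_tmul]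
      rfl
    rw [e]
    exact h ab.1 ab.2
  have hinj (φ : NormalizedBiDiffOp K C) (hφ : ∀ ab : C × C, evalBiDiff K ab.1 ab.2 φ = 0) :
      φ = 0 :=
    Subtype.ext (TensorProduct.ext' fun a b => hφ (a, b))
  obtain ⟨β, hβ, hβμ⟩ := exists_completedMap_eq (K := K) (V := NormalizedBiDiffOp K C)
    (fun ab : C × C => evalBiDiff K ab.1 ab.2) hinj _ hτ
  exact ⟨hμ, β, hβ, fun a b => sub_eq_iff_eq_add'.1 (hβμ (a, b))⟩

/-- Every star product is gauge equivalent to a differential one. -/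
theorem exists_gauge_isDifferentialStarProduct [Algebra.FormallySmooth K C]
    [Algebra.FiniteType K C] (hμ : IsStarProduct K R C μ) :
    ∃ g : CompletedTensor K R C ≃ₗ[R] CompletedTensor K R C,
      IsGaugeTransformation K R C g ∧ IsDifferentialStarProduct K R C (conjProduct g μ) := by
  have hcompl : IsAdicComplete (maximalIdeal R) (CompletedTensor K R C) :=
    isAdicComplete_completedTensor
  -- The exponent `n + 1` lets the recursion start at the identity, every star product being
  -- differential modulo `𝔪`.
  let P (n : ℕ) (g : CompletedTensor K R C ≃ₗ[R] CompletedTensor K R C) : Prop :=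
    (∀ x, g x - x ∈ (maximalIdeal R • ⊤ : Submodule R (CompletedTensor K R C))) ∧
      g (incl K R 1) = incl K R 1 ∧ IsDifferentialMod (conjProduct g μ) (n + 1)
  have step (n : ℕ) (g : {g // P n g}) : ∃ g' : {g // P (n + 1) g}, ∀ x, g'.1 x - g.1 x ∈
      (maximalIdeal R ^ n • ⊤ : Submodule R (CompletedTensor K R C)) := by
    obtain ⟨g, hg, hg1, hgd⟩ := g
    obtain ⟨H, hH, hH1, hHμ⟩ := exists_gauge_step (hμ.conjProduct g hg hg1) (Nat.le_add_left 1 n) hgd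
    have hHm (x) : H x ∈ (maximalIdeal R • ⊤ : Submodule R (CompletedTensor K R C)) := by
      have := pow_smul_top_le_smul_top _ (Nat.le_add_left 1 n) (hH x)
      rwa [pow_one] at this
    obtain ⟨e, he⟩ := exists_linearEquiv_add _ H hHm
    have hge (x) : (g.trans e) x - x ∈
        (maximalIdeal R • ⊤ : Submodule R (CompletedTensor K R C)) := by
      convert Submodule.add_mem _ (hg x) (hHm (g x)) using 1
      rw [LinearEquiv.trans_apply, he]
      abel
    have hge1 : (g.trans e) (incl K R 1) = incl K R 1 := by
      rw [LinearEquiv.trans_apply, hg1, he, hH1, add_zero]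
    refine ⟨⟨g.trans e, hge, hge1, hHμ _ (hμ.conjProduct _ hge hge1) fun a b => ?_⟩, fun x => ?_⟩
    · rw [← he, ← he, ← he]
      simp [conjProduct_apply]
    · convert pow_smul_top_le_smul_top _ (Nat.le_succ n) (hH (g x)) using 1
      rw [LinearEquiv.trans_apply, he]
      abel
  choose next hnext using step
  have base : P 0 (LinearEquiv.refl R _) := by
    refine ⟨by simp, rfl, isDifferentialMod_one ?_⟩
    exact hμ.conjProduct _ (by simp) rfl
  let g : (n : ℕ) → {g // P n g} := fun n => Nat.rec ⟨_, base⟩ next n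
  have hg (n : ℕ) (x) : (g (n + 1)).1 x - (g n).1 x ∈
      (maximalIdeal R ^ n • ⊤ : Submodule R (CompletedTensor K R C)) := hnext n (g n) x
  obtain ⟨F, hF⟩ := exists_limit_linearMap (maximalIdeal R) (fun n => (g n).1.toLinearMap) hg
  have hFm (x) : (F - LinearMap.id : CompletedTensor K R C →ₗ[R] CompletedTensor K R C) x ∈
      (maximalIdeal R • ⊤ : Submodule R (CompletedTensor K R C)) := by
    have h1 := hF 1 x
    rw [pow_one] at h1
    convert Submodule.add_mem _ h1 ((g 1).2.1 x) using 1
    simp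
  obtain ⟨e, he⟩ := exists_linearEquiv_add _ _ hFm
  have heF (x) : e x = F x := by rw [he]; simp
  have hem (x) : e x - x ∈ (maximalIdeal R • ⊤ : Submodule R (CompletedTensor K R C)) := by
    rw [he, add_sub_cancel_left]; exact hFm x
  have he1 : e (incl K R 1) = incl K R 1 := by
    refine eq_of_forall_sub_mem fun n => ?_
    have h1 := hF n (incl K R 1)
    rwa [LinearEquiv.coe_coe, (g n).2.2.1, ← heF] at h1
  refine ⟨e, ⟨fun a => ?_, he1⟩, isDifferentialStarProduct_of_forall_mod
    (hμ.conjProduct e hem he1) fun n => ?_⟩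
  · rw [← sub_eq_zero, ← map_sub]
    exact aug_eq_zero_of_mem _ (hem a)
  -- The limit agrees with `g n` modulo `𝔪 ^ n`, hence so do the transported products.
  · refine (g n).2.2.2.of_sub_mem (Nat.le_succ n) (conjProduct_sub_mem _ _ _ _ fun x => ?_)
    rw [heF]
    exact hF n x

end Gauge

end StarProduct

theorem mainTheorem7 (K R C : Type*) [Field K] [CharZero K]
    [CommRing R] [Algebra K R] [IsLocalRing R] [StarProduct.IsParameterAlgebra K R]
    [CommRing C] [IsDomain C] [Algebra K C] [Algebra.Smooth K C]
    (star : StarProduct.CompletedTensor K R C →ₗ[R] StarProduct.CompletedTensor K R C →ₗ[R]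
      StarProduct.CompletedTensor K R C)
    (hstar : StarProduct.IsStarProduct K R C star) :
    ∃ (g : StarProduct.CompletedTensor K R C ≃ₗ[R] StarProduct.CompletedTensor K R C)
      (star' : StarProduct.CompletedTensor K R C →ₗ[R] StarProduct.CompletedTensor K R C →ₗ[R]
        StarProduct.CompletedTensor K R C),
      StarProduct.IsGaugeTransformation K R C g ∧
      StarProduct.IsDifferentialStarProduct K R C star' ∧
      ∀ a₁ a₂, g (star a₁ a₂) = star' (g a₁) (g a₂) := by
  obtain ⟨g, hg, hd⟩ := StarProduct.exists_gauge_isDifferentialStarProduct hstar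
  exact ⟨g, StarProduct.conjProduct g star, hg, hd,
    fun a b => (StarProduct.conjProduct_apply_apply g star a b).symm⟩
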